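/- Let $\mathscr H=L^2((0,1),\mathbb R)\oplus L^2((0,1),\mathbb R)$ with its usual inner product, and for $f,g\in\mathscr H$ put $f\wedge g=\int_0^1\big(f_1(x)g_2(x)-f_2(x)g_1(x)\big)\,dx$. For $v=(v_1,v_2)\in\mathscr H$ consider on $[0,1]$ the Zakharov--Shabat system $$Jf'+Vf=\lambda f,\qquad J=\begin{pmatrix}0&1\\-1&0\end{pmatrix},\quad V=\begin{pmatrix}v_1&v_2\\v_2&-v_1\end{pmatrix},\quad \lambda\in\mathbb C,$$ and let $\vartheta=(\vartheta_1,\vartheta_2)^\top$, $\varphi=(\varphi_1,\varphi_2)^\top$ be its solutions with $\vartheta(0,\lambda)=(1,0)^\top$, $\varphi(0,\lambda)=(0,1)^\top$. Let $\nu_n(v)$, $\tau_n(v)$, $\varrho_n(v)$, $n\in\mathbb Z$, be the eigenvalues of the system under the boundary conditions $f_2(0)=f_2(1)=0$, $f_1(0)=f_2(1)=0$ and $f_2(0)=f_1(1)=0$ respectively; they are real and are labelled in strictly increasing order so that $\nu_n=\pi n+o(1)$ and $\tau_n,\varrho_n=\pi(n-\tfrac12)+o(1)$ as $n\to\pm\infty$.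 Define the norming constants $$\mathfrak s_n=-\log|\vartheta_1(1,\nu_n)|,\qquad \mathfrak t_n=-\log|\varphi_1(1,\tau_n)|,\qquad \mathfrak u_n=-\log|\vartheta_2(1,\varrho_n)|.$$ Then all these functions of $v$ are differentiable on $\mathscr H$, and, writing $'$ for the gradient with respect to $v$ in $\mathscr H$, for all $v\in\mathscr H$ and $n,j\in\mathbb Z$: $$\begin{aligned} \nu_n'\wedge\nu_j'&=0,&\mathfrak s_n'\wedge\nu_j'&=\delta_{nj},&\mathfrak s_n'\wedge\mathfrak s_j'&=0,\\ \tau_n'\wedge\tau_j'&=0,&\mathfrak t_n'\wedge\tau_j'&=\delta_{nj},&\mathfrak t_n'\wedge\mathfrak t_j'&=0,\\ \varrho_n'\wedge\varrho_j'&=0,&\mathfrak u_n'\wedge\varrho_j'&=\delta_{nj},&\mathfrak u_n'\wedge\mathfrak u_j'&=0. \end{aligned}$$ Moreover, for each $v\in\mathscr H$, each of the three families $\{\nu_n'(v),\mathfrak s_n'(v)\}_{n\in\mathbb Z}$, $\{\tau_n'(v),\mathfrak t_n'(v)\}_{n\in\mathbb Z}$, $\{\varrho_n'(v),\mathfrak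 u_n'(v)\}_{n\in\mathbb Z}$ is a (Riesz) basis of $\mathscr H$: the map sending square-summable coefficients to the corresponding linear combination of the family is a linear homeomorphism of $\ell^2$ onto $\mathscr H$. -/

import Mathlib

open MeasureTheory

noncomputable section

namespace ZS

/-- Lebesgue measure on the unit interval `(0,1)`. -/
abbrev unitMeasure : Measure ℝ := volume.restrict (Set.Ioo (0 : ℝ) 1)

/-- The real Hilbert space `𝓗 = L²((0,1),ℝ) ⊕ L²((0,1),ℝ)`. -/
abbrev H : Type := WithLp 2 (Lp ℝ 2 unitMeasure × Lp ℝ 2 unitMeasure)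

/-- The symplectic form `f ∧ g = ∫₀¹ (f₁ g₂ - f₂ g₁) dx`. -/
def wedge (f g : H) : ℝ :=
  ∫ x, (f.fst x * g.snd x - f.snd x * g.fst x) ∂unitMeasure

/-- The matrix `J`. -/
def J : Matrix (Fin 2) (Fin 2) ℂ := !![0, 1; -1, 0]

/-- The matrix potential `V` built from `v = (v₁, v₂)`. -/
def V (v : H) (x : ℝ) : Matrix (Fin 2) (Fin 2) ℂ :=
  !![(v.fst x : ℂ), (v.snd x : ℂ); (v.snd x : ℂ), -(v.fst x : ℂ)]

/-- `f` is an (absolutely continuous) solution on `[0,1]` of `J f' + V f = l f`.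
Since `J² = -1`, the equation is `f' = J (V - l) f`, and it is written in integrated form. -/
def IsSolution (v : H) (l : ℂ) (f : ℝ → Fin 2 → ℂ) : Prop :=
  ContinuousOn f (Set.Icc 0 1) ∧
  ∀ x ∈ Set.Icc (0 : ℝ) 1,
    f x = f 0 + ∫ t in (0 : ℝ)..x, (J * (V v t - l • (1 : Matrix (Fin 2) (Fin 2) ℂ))).mulVec (f t)

/-- The solution with initial value `a` at `0`; it is unique on `[0,1]`, and its values elsewhere
are irrelevant. -/
def solution (v : H) (l : ℂ) (a : Fin 2 → ℂ) : ℝ → Fin 2 → ℂ :=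
  Classical.epsilon fun f => IsSolution v l f ∧ f 0 = a

/-- The fundamental solution `ϑ(x, l)` with `ϑ(0, l) = (1, 0)`. -/
def theta (v : H) (l : ℂ) : ℝ → Fin 2 → ℂ := solution v l ![1, 0]

/-- The fundamental solution `φ(x, l)` with `φ(0, l) = (0, 1)`. -/
def phi (v : H) (l : ℂ) : ℝ → Fin 2 → ℂ := solution v l ![0, 1]

/-- The eigenvalues of `J f' + V f = l f` under the boundary conditions `f_i(0) = f_k(1) = 0`
(the components are numbered `0, 1` here). -/
def eigenvalues (v : H) (i k : Fin 2) : Set ℂ :=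
  {l | ∃ f : ℝ → Fin 2 → ℂ, IsSolution v l f ∧ (∃ x ∈ Set.Icc (0 : ℝ) 1, f x ≠ 0) ∧
    f 0 i = 0 ∧ f 1 k = 0}

/-- `s` is the strictly increasing enumeration by `ℤ` of the set `S`, labelled so that
`s n = c n + o(1)` as `n → ±∞`. There is at most one such `s`. -/
def IsLabelling (S : Set ℂ) (c : ℤ → ℝ) (s : ℤ → ℝ) : Prop :=
  StrictMono s ∧ Set.range (fun n => (s n : ℂ)) = S ∧
    Filter.Tendsto (fun n => s n - c n) Filter.cofinite (nhds 0)

/-- Neumann eigenvalues `ν_n`: `f₂(0) = f₂(1) = 0`, `ν_n = π n + o(1)`. -/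
def nu (n : ℤ) (v : H) : ℝ :=
  Classical.epsilon (IsLabelling (eigenvalues v 1 1) fun m => Real.pi * m) n

/-- Mixed eigenvalues of the first type `τ_n`: `f₁(0) = f₂(1) = 0`, `τ_n = π (n - 1/2) + o(1)`. -/
def tau (n : ℤ) (v : H) : ℝ :=
  Classical.epsilon (IsLabelling (eigenvalues v 0 1) fun m => Real.pi * (m - 1 / 2)) n

/-- Mixed eigenvalues of the second type `ϱ_n`: `f₂(0) = f₁(1) = 0`, `ϱ_n = π (n - 1/2) + o(1)`. -/
def rho (n : ℤ) (v : H) : ℝ :=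
  Classical.epsilon (IsLabelling (eigenvalues v 1 0) fun m => Real.pi * (m - 1 / 2)) n

/-- Norming constants `𝔰_n = -log |ϑ₁(1, ν_n)|`. -/
def normS (n : ℤ) (v : H) : ℝ := -Real.log ‖theta v (nu n v) 1 0‖

/-- Norming constants `𝔱_n = -log |φ₁(1, τ_n)|`. -/
def normT (n : ℤ) (v : H) : ℝ := -Real.log ‖phi v (tau n v) 1 0‖

/-- Norming constants `𝔲_n = -log |ϑ₂(1, ϱ_n)|`. -/
def normU (n : ℤ) (v : H) : ℝ := -Real.log ‖theta v (rho n v) 1 1‖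

/-- `e` is a basis of `𝓗`: the map `a ↦ ∑ a_i e_i` is a linear homeomorphism of `ℓ²` onto `𝓗`. -/
def IsBasis {ι : Type} [DecidableEq ι] (e : ι → H) : Prop :=
  ∃ T : lp (fun _ : ι => ℝ) 2 ≃L[ℝ] H, ∀ i, T (lp.single 2 i (1 : ℝ)) = e i

end ZS

end

noncomputable section

namespace ZS

open Set Filter Topology
open scoped ComplexConjugate

/-! ### Primitives of integrable functions on the unit interval -/

/-! For real `λ` put `z = f₁ + i f₂`. The system becomes `z' = iλz - i v z̄` with `v = v₁ + i v₂`,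
which is only real-linear. Let `z`, `y` be the solutions starting at `1` and `i`, so that `Im(z̄y) =
1`. The logarithmic derivative `z'/z = iλ - i v z̄/z` can be integrated directly. This gives a
smooth angle `ang (v, λ)` of `z(1)`, within `‖v‖` of `λ` and strictly increasing in `λ`. The
eigenvalues `ν_n` and `ϱ_n` are therefore the solutions of `ang = πn` and `ang = πn - π/2`, and the
norming constants are `-log |z(1)|` there. Rotation by a quarter turn changes `v` to `-v` and
reduces the `τ` problem to the `ϱ` problem.

The implicit function theorem and the variation of the Wronskian give the gradients `z²/∫|z|²`
(`hasGradientAt_ev`) and `(∫ Re ȳz) · z²/∫|z|² - zy` (`hasGradientAt_kap`). The wedge of two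
products of solutions, multiplied by the difference of the spectral parameters, is the integral of
the derivative of a product of two Wronskians (`wedge_sol`). At two eigenvalues of the same problem
the boundary terms vanish. For equal indices the identity `Im(z̄y) = 1` produces the `1` in
`δ_{nj}`.

For the basis property, the gradients at `v = 0` are `e^{2icx}` and `-i e^{2icx}` at the nodes `c =
πn - b`, a real orthonormal basis. Integration by parts bounds the deviation of the actual gradients
by `eps v c`, built from the oscillatory integrals `∫₀ˣ v e^{-2ict} dt` (`exists_norm_grad_sub_le`).
By Parseval these bounds are square summable over the nodes (`summable_eps_sq`). The canonical
relations say that wedging with the conjugate gradients yields coordinate functionals, so the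
synthesis operator is injective. Being an invertible operator plus a Hilbert–Schmidt one, it is then
also surjective (`exists_equiv_of_quadratically_close`). -/

/-- `f` is, on `[0,1]`, a primitive of the integrable function `g`. -/
structure Prim (f g : ℝ → ℂ) : Prop where
  int : Integrable g unitMeasure
  eq : ∀ x ∈ Icc (0 : ℝ) 1, f x = f 0 + ∫ t in (0 : ℝ)..x, g t

theorem intervalIntegrable_of_integrable {E : Type*} [NormedAddCommGroup E] {g : ℝ → E}
    (hg : Integrable g unitMeasure) : IntervalIntegrable g volume 0 1 := by
  rw [intervalIntegrable_iff_integrableOn_Ioo_of_le zero_le_one]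
  exact hg

theorem integrable_of_intervalIntegrable {E : Type*} [NormedAddCommGroup E] {g : ℝ → E}
    (hg : IntervalIntegrable g volume 0 1) : Integrable g unitMeasure := by
  rw [intervalIntegrable_iff_integrableOn_Ioo_of_le zero_le_one] at hg
  exact hg

theorem intervalIntegral_eq_integral {E : Type*} [NormedAddCommGroup E] [NormedSpace ℝ E]
    (g : ℝ → E) : ∫ t in (0 : ℝ)..1, g t = ∫ t, g t ∂unitMeasure := by
  rw [intervalIntegral.integral_of_le zero_le_one, integral_Ioc_eq_integral_Ioo]

theorem AbsolutelyContinuousOnInterval.lipschitz_comp {E F : Type*} [PseudoMetricSpace E]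
    [PseudoMetricSpace F] {f : ℝ → E} {φ : E → F} {K : NNReal} {s : Set E} {a b : ℝ}
    (hf : AbsolutelyContinuousOnInterval f a b) (hφ : LipschitzOnWith K φ s)
    (hs : MapsTo f (uIcc a b) s) :
    AbsolutelyContinuousOnInterval (fun x => φ (f x)) a b := by
  rw [absolutelyContinuousOnInterval_iff] at hf ⊢
  intro ε hε
  -- The divisor is `K + 1` because `K` may be zero.
  obtain ⟨δ, hδ, h⟩ := hf (ε / (K + 1)) (by positivity)
  refine ⟨δ, hδ, fun E hE hlt => ?_⟩
  calc _ ≤ ∑ i ∈ Finset.range E.1, K * dist (f (E.2 i).1) (f (E.2 i).2) :=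
        Finset.sum_le_sum fun i hi => hφ.dist_le_mul _ (hs (hE.1 i hi).1) _ (hs (hE.1 i hi).2)
    _ = K * ∑ i ∈ Finset.range E.1, dist (f (E.2 i).1) (f (E.2 i).2) := by rw [Finset.mul_sum]
    _ ≤ K * (ε / (K + 1)) := by gcongr; exact (h E hE hlt).le
    _ < (K + 1) * (ε / (K + 1)) := by gcongr; linarith
    _ = ε := by field

theorem absolutelyContinuous_integral {g : ℝ → ℂ} (hg : IntervalIntegrable g volume 0 1) :
    AbsolutelyContinuousOnInterval (fun x => ∫ t in (0 : ℝ)..x, g t) 0 1 := by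
  have h1 : IntervalIntegrable (fun t => (g t).re) volume 0 1 :=
    ⟨hg.1.re, hg.2.re⟩
  have h2 : IntervalIntegrable (fun t => (g t).im) volume 0 1 :=
    ⟨hg.1.im, hg.2.im⟩
  have a1 := h1.absolutelyContinuousOnInterval_intervalIntegral (c := 0) (by simp)
  have a2 := h2.absolutelyContinuousOnInterval_intervalIntegral (c := 0) (by simp)
  have b1 := AbsolutelyContinuousOnInterval.lipschitz_comp a1
    (Complex.isometry_ofReal.lipschitz.lipschitzOnWith (s := univ)) (mapsTo_univ _ _)
  have b2 := AbsolutelyContinuousOnInterval.lipschitz_comp a2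
    (Complex.isometry_ofReal.lipschitz.lipschitzOnWith (s := univ)) (mapsTo_univ _ _)
  have b3 := b1.add (b2.const_smul Complex.I)
  rw [absolutelyContinuousOnInterval_iff] at b3 ⊢
  intro ε hε
  obtain ⟨δ, hδ, h⟩ := b3 ε hε
  refine ⟨δ, hδ, fun E hE hlt => ?_⟩
  convert h E hE hlt using 2 with i hi
  have key : ∀ x ∈ uIcc (0 : ℝ) 1, (∫ t in (0 : ℝ)..x, g t) =
      ((fun x => ((∫ t in (0 : ℝ)..x, (g t).re : ℝ) : ℂ)) +
      Complex.I • (fun x => ((∫ t in (0 : ℝ)..x, (g t).im : ℝ) : ℂ))) x := by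
    intro x hx
    have hgx : IntervalIntegrable g volume 0 x :=
      hg.mono_set (uIcc_subset_uIcc (by simp) hx)
    apply Complex.ext
    · have := Complex.reCLM.intervalIntegral_comp_comm hgx
      simpa using this.symm
    · have := Complex.imCLM.intervalIntegral_comp_comm hgx
      simpa using this.symm
  rw [key _ (hE.1 i hi).1, key _ (hE.1 i hi).2]
  rfl

namespace Prim

variable {f g f₁ g₁ f₂ g₂ : ℝ → ℂ}

theorem absolutelyContinuous (h : Prim f g) : AbsolutelyContinuousOnInterval f 0 1 := by
  have h1 := absolutelyContinuous_integral (intervalIntegrable_of_integrable h.int)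
  rw [absolutelyContinuousOnInterval_iff] at h1 ⊢
  intro ε hε
  obtain ⟨δ, hδ, h2⟩ := h1 ε hε
  refine ⟨δ, hδ, fun E hE hlt => ?_⟩
  convert h2 E hE hlt using 2 with i hi
  have m1 := (hE.1 i hi).1
  have m2 := (hE.1 i hi).2
  rw [uIcc_of_le zero_le_one] at m1 m2
  rw [h.eq _ m1, h.eq _ m2, dist_add_left]

theorem continuousOn (h : Prim f g) : ContinuousOn f (Icc 0 1) := by
  have := h.absolutelyContinuous.continuousOn
  rwa [uIcc_of_le zero_le_one] at this

theorem ae_hasDerivAt (h : Prim f g) : ∀ᵐ x, x ∈ Icc (0 : ℝ) 1 → HasDerivAt f (g x) x := by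
  have h0 : ∀ᵐ x : ℝ, x ≠ 0 := by simp [ae_iff, measure_singleton]
  have h1 : ∀ᵐ x : ℝ, x ≠ 1 := by simp [ae_iff, measure_singleton]
  filter_upwards [(intervalIntegrable_of_integrable h.int).ae_hasDerivAt_integral, h0, h1]
    with x hx hx0 hx1 hx2
  rw [uIcc_of_le zero_le_one] at hx
  have := (hx hx2 0 (by simp)).const_add (f 0)
  refine this.congr_of_eventuallyEq ?_
  have hm : Icc (0 : ℝ) 1 ∈ 𝓝 x :=
    Icc_mem_nhds (lt_of_le_of_ne hx2.1 (Ne.symm hx0)) (lt_of_le_of_ne hx2.2 hx1)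
  filter_upwards [hm] with y hy using h.eq y hy

/-- The difference between `f` and the integral of `g` is absolutely continuous with derivative zero
almost everywhere, hence constant. All the calculus rules below reduce to this criterion. -/
theorem of_ae_hasDerivAt (hf : AbsolutelyContinuousOnInterval f 0 1)
    (hg : Integrable g unitMeasure) (h : ∀ᵐ x, x ∈ Icc (0 : ℝ) 1 → HasDerivAt f (g x) x) :
    Prim f g := by
  refine ⟨hg, ?_⟩
  have hi := intervalIntegrable_of_integrable hg
  have hs := hf.sub (absolutelyContinuous_integral hi)
  obtain ⟨C, hC⟩ := hs.const_of_ae_hasDerivAt_zero (by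
    filter_upwards [h, hi.ae_hasDerivAt_integral] with x h1 h2 hx
    have := (h1 (by rwa [uIcc_of_le zero_le_one] at hx)).sub (h2 hx 0 (by simp))
    simpa using this)
  rw [uIcc_of_le zero_le_one] at hC
  intro x hx
  have e0 := hC 0 (by simp)
  have ex := hC x hx
  simp at e0 ex
  rw [e0, ← ex]; ring

theorem integrable_mul (h : Prim f g) {k : ℝ → ℂ} (hk : Integrable k unitMeasure) :
    Integrable (fun x => f x * k x) unitMeasure := by
  have := (intervalIntegrable_of_integrable hk).continuousOn_mul
    (by rw [uIcc_of_le zero_le_one]; exact h.continuousOn)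
  exact integrable_of_intervalIntegrable this

theorem mul (h₁ : Prim f₁ g₁) (h₂ : Prim f₂ g₂) :
    Prim (fun x => f₁ x * f₂ x) (fun x => g₁ x * f₂ x + f₁ x * g₂ x) := by
  refine of_ae_hasDerivAt ?_ ?_ ?_
  · exact h₁.absolutelyContinuous.smul h₂.absolutelyContinuous
  · refine Integrable.add ?_ (h₁.integrable_mul h₂.int)
    simpa only [mul_comm] using h₂.integrable_mul h₁.int
  · filter_upwards [h₁.ae_hasDerivAt, h₂.ae_hasDerivAt] with x a b hx
    exact (a hx).mul (b hx)

theorem add (h₁ : Prim f₁ g₁) (h₂ : Prim f₂ g₂) :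
    Prim (fun x => f₁ x + f₂ x) (fun x => g₁ x + g₂ x) := by
  refine of_ae_hasDerivAt (h₁.absolutelyContinuous.add h₂.absolutelyContinuous)
    (h₁.int.add h₂.int) ?_
  filter_upwards [h₁.ae_hasDerivAt, h₂.ae_hasDerivAt] with x a b hx
  exact (a hx).add (b hx)

theorem const (c : ℂ) : Prim (fun _ => c) (fun _ => 0) := ⟨by simp, by simp⟩

theorem const_mul (c : ℂ) (h : Prim f g) : Prim (fun x => c * f x) (fun x => c * g x) := by
  simpa using (Prim.const c).mul h

theorem sub (h₁ : Prim f₁ g₁) (h₂ : Prim f₂ g₂) :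
    Prim (fun x => f₁ x - f₂ x) (fun x => g₁ x - g₂ x) := by
  simpa [sub_eq_add_neg] using h₁.add (h₂.const_mul (-1))

theorem conjugate (h : Prim f g) : Prim (fun x => conj (f x)) (fun x => conj (g x)) := by
  refine of_ae_hasDerivAt ?_ ?_ ?_
  · exact AbsolutelyContinuousOnInterval.lipschitz_comp h.absolutelyContinuous
      (Complex.isometry_conj.lipschitz.lipschitzOnWith (s := univ)) (mapsTo_univ _ _)
  · exact (Complex.conjLIE.toContinuousLinearEquiv.integrable_comp_iff).2 h.int
  · filter_upwards [h.ae_hasDerivAt] with x a hx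
    exact (a hx).star

/-- The exponential is only locally Lipschitz, which suffices because `f` maps `[0,1]` into a ball.
-/
theorem cexp (h : Prim f g) :
    Prim (fun x => Complex.exp (f x)) (fun x => g x * Complex.exp (f x)) := by
  have hc : IsCompact (f '' Icc 0 1) := isCompact_Icc.image_of_continuousOn h.continuousOn
  obtain ⟨R, hR⟩ := hc.isBounded.subset_closedBall 0
  have hexp : ContDiff ℝ 1 Complex.exp := (Complex.contDiff_exp (𝕜 := ℂ)).restrict_scalars ℝ
  obtain ⟨K, hK⟩ := hexp.contDiffOn.exists_lipschitzOnWith (by decide)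
    (convex_closedBall (0 : ℂ) R) (isCompact_closedBall (0 : ℂ) R)
  have hac : AbsolutelyContinuousOnInterval (fun x => Complex.exp (f x)) 0 1 := by
    refine AbsolutelyContinuousOnInterval.lipschitz_comp h.absolutelyContinuous hK ?_
    rw [uIcc_of_le zero_le_one]
    exact fun x hx => hR ⟨x, hx, rfl⟩
  refine of_ae_hasDerivAt hac ?_ ?_
  · have := (intervalIntegrable_of_integrable h.int).mul_continuousOn hac.continuousOn
    exact integrable_of_intervalIntegrable this
  · filter_upwards [h.ae_hasDerivAt] with x a hx
    simpa [mul_comm] using (a hx).cexp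

theorem congr (h : Prim f g) (h₁ : ∀ x ∈ Icc (0 : ℝ) 1, f₁ x = f x) (h₂ : g₁ =ᵐ[unitMeasure] g) :
    Prim f₁ g₁ := by
  refine ⟨h.int.congr h₂.symm, fun x hx => ?_⟩
  rw [h₁ x hx, h₁ 0 (by simp), h.eq x hx]
  congr 1
  refine intervalIntegral.integral_congr_ae ?_
  have := (ae_restrict_iff' measurableSet_Ioo).1 h₂
  have h1 : ∀ᵐ x : ℝ, x ≠ 1 := by simp [ae_iff, measure_singleton]
  filter_upwards [this, h1] with t ht ht1 hmem
  rw [uIoc_of_le hx.1] at hmem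
  exact (ht ⟨hmem.1, lt_of_le_of_ne (hmem.2.trans hx.2) ht1⟩).symm

theorem id : Prim (fun x => (x : ℂ)) (fun _ => 1) := by
  refine ⟨by simp, fun x hx => by simp⟩

theorem eq_one (h : Prim f g) : f 1 = f 0 + ∫ t, g t ∂unitMeasure := by
  rw [h.eq 1 (by simp), intervalIntegral_eq_integral]

theorem eq_of_ae_zero (h : Prim f g) (hg : g =ᵐ[unitMeasure] 0) :
    ∀ x ∈ Icc (0 : ℝ) 1, f x = f 0 := by
  intro x hx
  have := (h.congr (fun _ _ => rfl) hg.symm).eq x hx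
  simpa using this

theorem norm_sub_le (h : Prim f g) {x : ℝ} (hx : x ∈ Icc (0 : ℝ) 1) :
    ‖f x - f 0‖ ≤ ∫ t, ‖g t‖ ∂unitMeasure := by
  rw [h.eq x hx, add_sub_cancel_left]
  refine (intervalIntegral.norm_integral_le_integral_norm hx.1).trans ?_
  rw [← intervalIntegral_eq_integral]
  refine intervalIntegral.integral_mono_interval le_rfl hx.1 hx.2 ?_
    (intervalIntegrable_of_integrable h.int.norm)
  exact Eventually.of_forall fun _ => norm_nonneg _

end Prim

/-! ### Complex form of the potential -/

/-- The complex potential `v₁ + i v₂`. -/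
def pot (v : H) (t : ℝ) : ℂ := (v.fst t : ℂ) + (v.snd t : ℂ) * Complex.I

theorem pot_re (v : H) (t : ℝ) : (pot v t).re = v.fst t := by simp [pot]

theorem pot_im (v : H) (t : ℝ) : (pot v t).im = v.snd t := by simp [pot]

theorem memLp_pot (v : H) : MemLp (pot v) 2 unitMeasure :=
  ((Lp.memLp v.fst).ofReal (K := ℂ)).add (((Lp.memLp v.snd).ofReal (K := ℂ)).mul_const Complex.I)

theorem integrable_pot (v : H) : Integrable (pot v) unitMeasure :=
  (memLp_pot v).integrable (by norm_num)

theorem pot_add (v w : H) : pot (v + w) =ᵐ[unitMeasure] fun t => pot v t + pot w t := by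
  filter_upwards [Lp.coeFn_add v.fst w.fst, Lp.coeFn_add v.snd w.snd] with t h1 h2
  have e1 : (v + w).fst = v.fst + w.fst := rfl
  have e2 : (v + w).snd = v.snd + w.snd := rfl
  simp only [pot, e1, e2, h1, h2, Pi.add_apply]
  push_cast; ring

theorem pot_smul (r : ℝ) (v : H) : pot (r • v) =ᵐ[unitMeasure] fun t => (r : ℂ) * pot v t := by
  filter_upwards [Lp.coeFn_smul r v.fst, Lp.coeFn_smul r v.snd] with t h1 h2
  have e1 : (r • v).fst = r • v.fst := rfl
  have e2 : (r • v).snd = r • v.snd := rfl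
  simp only [pot, e1, e2, h1, h2, Pi.smul_apply, smul_eq_mul]
  push_cast; ring

theorem pot_neg (v : H) : pot (-v) =ᵐ[unitMeasure] fun t => -pot v t := by
  filter_upwards [pot_smul (-1) v] with t h
  simpa using h

theorem inner_eq_integral (u v : H) :
    inner ℝ u v = ∫ t, (conj (pot u t) * pot v t).re ∂unitMeasure := by
  rw [WithLp.prod_inner_apply, L2.inner_def, L2.inner_def, ← integral_add]
  · refine integral_congr_ae (Eventually.of_forall fun t => ?_)
    simp [pot]; ring
  · exact L2.integrable_inner _ _
  · exact L2.integrable_inner _ _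

theorem norm_sq_eq_integral (v : H) : ‖v‖ ^ 2 = ∫ t, ‖pot v t‖ ^ 2 ∂unitMeasure := by
  rw [← real_inner_self_eq_norm_sq, inner_eq_integral]
  refine integral_congr_ae (Eventually.of_forall fun t => ?_)
  simp only
  rw [mul_comm, Complex.mul_conj, Complex.normSq_eq_norm_sq]
  norm_cast

theorem wedge_eq_integral (u v : H) :
    wedge u v = ∫ t, (conj (pot u t) * pot v t).im ∂unitMeasure := by
  refine integral_congr_ae (Eventually.of_forall fun t => ?_)
  simp [pot]; ring

theorem sq_integral_mul_le {f g : ℝ → ℝ} {μ : Measure ℝ} (hf : MemLp f 2 μ) (hg : MemLp g 2 μ)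
    (hf0 : ∀ t, 0 ≤ f t) (hg0 : ∀ t, 0 ≤ g t) :
    (∫ t, f t * g t ∂μ) ^ 2 ≤ (∫ t, f t ^ 2 ∂μ) * ∫ t, g t ^ 2 ∂μ := by
  have h := integral_mul_le_Lp_mul_Lq_of_nonneg (μ := μ) (p := 2) (q := 2)
    (Real.holderConjugate_iff.2 ⟨by norm_num, by norm_num⟩) (Eventually.of_forall hf0)
    (Eventually.of_forall hg0) (by simpa using hf) (by simpa using hg)
  simp only [Real.rpow_two, ← Real.sqrt_eq_rpow] at h
  have h0 : 0 ≤ ∫ t, f t * g t ∂μ := integral_nonneg fun t => mul_nonneg (hf0 t) (hg0 t)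
  calc _ ≤ (√(∫ t, f t ^ 2 ∂μ) * √(∫ t, g t ^ 2 ∂μ)) ^ 2 := by gcongr
    _ = _ := by
      rw [mul_pow, Real.sq_sqrt (integral_nonneg fun t => sq_nonneg _),
        Real.sq_sqrt (integral_nonneg fun t => sq_nonneg _)]

theorem integral_norm_pot_mul_le (v : H) {g : ℝ → ℂ} (hg : MemLp g 2 unitMeasure) :
    ∫ t, ‖pot v t‖ * ‖g t‖ ∂unitMeasure ≤ ‖v‖ * √(∫ t, ‖g t‖ ^ 2 ∂unitMeasure) := by
  have h := sq_integral_mul_le (memLp_pot v).norm hg.norm (fun t => norm_nonneg _)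
    (fun t => norm_nonneg _)
  rw [← norm_sq_eq_integral] at h
  refine (le_abs_self _).trans (abs_le_of_sq_le_sq ?_ (by positivity))
  rwa [mul_pow, Real.sq_sqrt (integral_nonneg fun t => sq_nonneg _)]

instance : IsProbabilityMeasure unitMeasure := ⟨by simp [unitMeasure]⟩

theorem integral_norm_pot_le (v : H) : ∫ t, ‖pot v t‖ ∂unitMeasure ≤ ‖v‖ := by
  simpa using integral_norm_pot_mul_le v (memLp_const (1 : ℂ))

/-! ### The Volterra operator of the system -/

/-- The Banach space in which the system is solved. -/
abbrev X : Type := BoundedContinuousFunction ℝ ℂ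

/-- The retraction of `ℝ` onto `[0,1]`. -/
def clamp (x : ℝ) : ℝ := max 0 (min 1 x)

theorem clamp_mem (x : ℝ) : clamp x ∈ Icc (0 : ℝ) 1 := by
  simp [clamp]

theorem clamp_of_mem {x : ℝ} (hx : x ∈ Icc (0 : ℝ) 1) : clamp x = x := by
  simp [clamp, hx.1, hx.2]

theorem continuous_clamp : Continuous clamp := by
  unfold clamp; fun_prop

theorem intervalIntegral_congr_unit {E : Type*} [NormedAddCommGroup E] [NormedSpace ℝ E]
    {g₁ g₂ : ℝ → E} (h : g₁ =ᵐ[unitMeasure] g₂) {x : ℝ}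
    (hx : x ∈ Icc (0 : ℝ) 1) : ∫ t in (0 : ℝ)..x, g₁ t = ∫ t in (0 : ℝ)..x, g₂ t := by
  refine intervalIntegral.integral_congr_ae ?_
  have := (ae_restrict_iff' measurableSet_Ioo).1 h
  have h1 : ∀ᵐ x : ℝ, x ≠ 1 := by simp [ae_iff, measure_singleton]
  filter_upwards [this, h1] with t ht ht1 hmem
  rw [uIoc_of_le hx.1] at hmem
  exact ht ⟨hmem.1, lt_of_le_of_ne (hmem.2.trans hx.2) ht1⟩

theorem intervalIntegrable_unit {E : Type*} [NormedAddCommGroup E] {g : ℝ → E}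
    (hg : Integrable g unitMeasure) {x : ℝ} (hx : x ∈ Icc (0 : ℝ) 1) :
    IntervalIntegrable g volume 0 x :=
  (intervalIntegrable_of_integrable hg).mono_set
    (uIcc_subset_uIcc (by simp) (by rwa [uIcc_of_le zero_le_one]))

theorem norm_intervalIntegral_le_unit {g : ℝ → ℂ} (hg : Integrable g unitMeasure) {x : ℝ}
    (hx : x ∈ Icc (0 : ℝ) 1) : ‖∫ t in (0 : ℝ)..x, g t‖ ≤ ∫ t, ‖g t‖ ∂unitMeasure := by
  have hp : Prim (fun x => ∫ t in (0 : ℝ)..x, g t) g := ⟨hg, by simp⟩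
  simpa using hp.norm_sub_le hx

/-- The primitive of an integrable function, as a bounded continuous function. -/
def primB (g : ℝ → ℂ) (hg : Integrable g unitMeasure) : X :=
  BoundedContinuousFunction.ofNormedAddCommGroup (fun x => ∫ t in (0 : ℝ)..clamp x, g t)
    (by
      have hp : Prim (fun x => ∫ t in (0 : ℝ)..x, g t) g := ⟨hg, by simp⟩
      exact hp.continuousOn.comp_continuous continuous_clamp clamp_mem)
    (∫ t, ‖g t‖ ∂unitMeasure) (fun x => norm_intervalIntegral_le_unit hg (clamp_mem x))

theorem primB_apply (g : ℝ → ℂ) (hg : Integrable g unitMeasure) (x : ℝ) :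
    primB g hg x = ∫ t in (0 : ℝ)..clamp x, g t := rfl

theorem norm_primB_le (g : ℝ → ℂ) (hg : Integrable g unitMeasure) :
    ‖primB g hg‖ ≤ ∫ t, ‖g t‖ ∂unitMeasure :=
  BoundedContinuousFunction.norm_ofNormedAddCommGroup_le _
    (integral_nonneg fun _ => norm_nonneg _) _

theorem X.memLp (z : X) : MemLp z 2 unitMeasure :=
  MemLp.of_bound z.continuous.aestronglyMeasurable ‖z‖ (Eventually.of_forall z.norm_coe_le_norm)

theorem X.integrable (z : X) : Integrable z unitMeasure :=
  z.memLp.integrable (by norm_num)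

/-- The right-hand side of the equation `z' = i λ z - i v z̄` for `z = f₁ + i f₂`. -/
def rhs (v : H) (l : ℝ) (z : ℝ → ℂ) (t : ℝ) : ℂ :=
  Complex.I * l * z t - Complex.I * pot v t * conj (z t)

theorem norm_rhs_le (v : H) (l : ℝ) (z : ℝ → ℂ) (t : ℝ) :
    ‖rhs v l z t‖ ≤ (|l| + ‖pot v t‖) * ‖z t‖ := by
  refine (_root_.norm_sub_le _ _).trans ?_
  simp [add_mul]

theorem integrable_rhs (v : H) (l : ℝ) (z : X) : Integrable (rhs v l z) unitMeasure := by
  refine Integrable.sub (z.integrable.const_mul _) ?_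
  have : Integrable (fun t => Complex.I * pot v t) unitMeasure := (integrable_pot v).const_mul _
  refine this.mul_bdd (c := ‖z‖) ?_ ?_
  · exact (Complex.continuous_conj.comp z.continuous).aestronglyMeasurable
  · exact Eventually.of_forall fun t => by simpa using z.norm_coe_le_norm t

/-- The Volterra operator `z ↦ ∫₀ˣ (i λ z - i v z̄)`, depending linearly on `(v, λ)`. -/
def volterra : (H × ℝ) →L[ℝ] X →L[ℝ] X :=
  LinearMap.mkContinuous₂
    (LinearMap.mk₂ ℝ (fun (p : H × ℝ) (z : X) => primB (rhs p.1 p.2 z) (integrable_rhs _ _ _))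
      (by
        intro p q z
        ext x
        simp only [primB_apply, BoundedContinuousFunction.add_apply]
        rw [← intervalIntegral.integral_add
          (intervalIntegrable_unit (integrable_rhs _ _ _) (clamp_mem x))
          (intervalIntegrable_unit (integrable_rhs _ _ _) (clamp_mem x))]
        refine intervalIntegral_congr_unit ?_ (clamp_mem x)
        filter_upwards [pot_add p.1 q.1] with t ht
        simp only [rhs, Prod.fst_add, Prod.snd_add, ht]
        push_cast; ring)
      (by
        intro c p z
        ext x
        simp only [primB_apply, BoundedContinuousFunction.smul_apply]
        rw [← intervalIntegral.integral_smul]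
        refine intervalIntegral_congr_unit ?_ (clamp_mem x)
        filter_upwards [pot_smul c p.1] with t ht
        simp only [rhs, Prod.smul_fst, Prod.smul_snd, ht, Complex.real_smul, smul_eq_mul]
        push_cast; ring)
      (by
        intro p z w
        ext x
        simp only [primB_apply, BoundedContinuousFunction.add_apply]
        rw [← intervalIntegral.integral_add
          (intervalIntegrable_unit (integrable_rhs _ _ _) (clamp_mem x))
          (intervalIntegrable_unit (integrable_rhs _ _ _) (clamp_mem x))]
        congr 1; ext t
        simp only [rhs, BoundedContinuousFunction.coe_add, Pi.add_apply, map_add]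
        ring)
      (by
        intro c p z
        ext x
        simp only [primB_apply, BoundedContinuousFunction.smul_apply]
        rw [← intervalIntegral.integral_smul]
        congr 1; ext t
        simp only [rhs, BoundedContinuousFunction.coe_smul, Complex.real_smul, map_mul,
          Complex.conj_ofReal]
        ring))
    -- One unit comes from `|λ| ≤ ‖p‖`, the other from `∫|v| ≤ ‖v‖ ≤ ‖p‖`.
    2 (by
      intro p z
      refine (norm_primB_le _ (integrable_rhs p.1 p.2 z)).trans ?_
      have h1 : ∫ t, ‖rhs p.1 p.2 z t‖ ∂unitMeasure ≤
          ∫ t, (|p.2| + ‖pot p.1 t‖) * ‖z‖ ∂unitMeasure := by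
        refine integral_mono (integrable_rhs _ _ _).norm ?_ fun t => ?_
        · exact ((integrable_const _).add (integrable_pot p.1).norm).mul_const _
        · refine (norm_rhs_le _ _ _ _).trans ?_
          gcongr
          exact z.norm_coe_le_norm t
      refine h1.trans ?_
      rw [integral_mul_const, integral_add (integrable_const _) (integrable_pot p.1).norm]
      have h2 := integral_norm_pot_le p.1
      have h3 : ‖p.1‖ ≤ ‖p‖ := norm_fst_le p
      have h4 : |p.2| ≤ ‖p‖ := norm_snd_le p
      simp only [integral_const, probReal_univ, one_smul]
      gcongr
      linarith)

theorem volterra_apply (p : H × ℝ) (z : X) (x : ℝ) :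
    volterra p z x = ∫ t in (0 : ℝ)..clamp x, rhs p.1 p.2 z t := rfl

theorem volterra_apply_clamp (p : H × ℝ) (z : X) (x : ℝ) :
    volterra p z (clamp x) = volterra p z x := by
  rw [volterra_apply, volterra_apply, clamp_of_mem (clamp_mem x)]

theorem prim_volterra (p : H × ℝ) (z : X) : Prim (volterra p z) (rhs p.1 p.2 z) := by
  refine ⟨integrable_rhs _ _ _, fun x hx => ?_⟩
  simp [volterra_apply, clamp_of_mem hx, clamp_of_mem (x := 0) (by simp)]

/-- Cauchy–Schwarz on `[0,x]`, with `C = ∫(|λ| + |v|)²`. The potential is merely square integrable,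
so it is the squared inequality, with an integral over `[0,x]` only, that can be iterated. -/
theorem exists_sq_volterra_le (p : H × ℝ) : ∃ C : ℝ, 0 ≤ C ∧ ∀ (z : X), ∀ x ∈ Icc (0 : ℝ) 1,
    ‖volterra p z x‖ ^ 2 ≤ C * ∫ t in (0 : ℝ)..x, ‖z t‖ ^ 2 := by
  have hm : MemLp (fun t => |p.2| + ‖pot p.1 t‖) 2 unitMeasure := by
    have h1 : MemLp (fun _ : ℝ => |p.2|) 2 unitMeasure := memLp_const _
    exact h1.add (memLp_pot p.1).norm
  refine ⟨∫ t, (|p.2| + ‖pot p.1 t‖) ^ 2 ∂unitMeasure, integral_nonneg fun _ => sq_nonneg _,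
    fun z x hx => ?_⟩
  rw [volterra_apply, clamp_of_mem hx]
  have hset : volume.restrict (Ioc 0 x) ≤ unitMeasure := by
    have : volume.restrict (Ioc (0:ℝ) 1) = unitMeasure := restrict_Ioo_eq_restrict_Ioc.symm
    rw [← this]
    exact Measure.restrict_mono (Ioc_subset_Ioc_right hx.2) le_rfl
  have h1 : ‖∫ t in (0 : ℝ)..x, rhs p.1 p.2 z t‖ ≤
      ∫ t in (0 : ℝ)..x, (|p.2| + ‖pot p.1 t‖) * ‖z t‖ := by
    refine intervalIntegral.norm_integral_le_of_norm_le hx.1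
      (Eventually.of_forall fun t _ => norm_rhs_le _ _ _ _) ?_
    refine intervalIntegrable_unit ?_ hx
    exact hm.integrable_mul z.memLp.norm
  have h2 := sq_integral_mul_le (hm.mono_measure hset) (z.memLp.norm.mono_measure hset)
    (fun t => by positivity) (fun t => norm_nonneg _)
  simp only [← intervalIntegral.integral_of_le hx.1] at h2
  calc _ ≤ (∫ t in (0 : ℝ)..x, (|p.2| + ‖pot p.1 t‖) * ‖z t‖) ^ 2 := by gcongr
    _ ≤ _ := h2
    _ ≤ _ := by
      refine mul_le_mul_of_nonneg_right ?_
        (intervalIntegral.integral_nonneg hx.1 fun _ _ => by positivity)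
      rw [intervalIntegral.integral_of_le hx.1]
      exact integral_mono_measure hset (Eventually.of_forall fun _ => sq_nonneg _)
          hm.integrable_sq

/-- Iteration gives `‖Kⁿ‖² ≤ Cⁿ/n!`, so some `1 - Kⁿ` is invertible. It factors as `1 - K` times a
commuting geometric sum, and so `1 - K` is invertible too. -/
theorem isUnit_one_sub_volterra (p : H × ℝ) : IsUnit (1 - volterra p) := by
  obtain ⟨C, hC, h⟩ := exists_sq_volterra_le p
  have key : ∀ (n : ℕ) (z : X), ∀ x ∈ Icc (0 : ℝ) 1,
      ‖((volterra p) ^ n) z x‖ ^ 2 ≤ C ^ n * x ^ n / n.factorial * ‖z‖ ^ 2 := by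
    intro n z
    induction n with
    | zero =>
      intro x hx
      simp only [pow_zero, one_apply_eq_self, Nat.factorial_zero, Nat.cast_one,
        mul_one, div_one, one_mul]
      gcongr
      exact z.norm_coe_le_norm x
    | succ n ih =>
      intro x hx
      rw [pow_succ' (volterra p), mul_apply_eq_comp]
      refine (h _ x hx).trans ?_
      have : ∫ t in (0 : ℝ)..x, ‖((volterra p) ^ n) z t‖ ^ 2 ≤
          ∫ t in (0 : ℝ)..x, C ^ n * t ^ n / n.factorial * ‖z‖ ^ 2 := by
        refine intervalIntegral.integral_mono_on hx.1 ?_ ?_ ?_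
        · exact Continuous.intervalIntegrable (by fun_prop) _ _
        · exact Continuous.intervalIntegrable (by fun_prop) _ _
        · exact fun t ht => ih t ⟨ht.1, ht.2.trans hx.2⟩
      calc _ ≤ C * ∫ t in (0 : ℝ)..x, C ^ n * t ^ n / n.factorial * ‖z‖ ^ 2 := by gcongr
        _ = _ := by
          have e : ∀ t : ℝ, C ^ n * t ^ n / n.factorial * ‖z‖ ^ 2 =
            (C ^ n / n.factorial * ‖z‖ ^ 2) * t ^ n := fun t => by ring
          simp_rw [e]
          rw [intervalIntegral.integral_const_mul, integral_pow, Nat.factorial_succ]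
          have := Nat.factorial_ne_zero n
          push_cast
          field_simp
          simp [pow_succ]
          ring
  obtain ⟨n, hn, hn1⟩ := ((FloorSemiring.tendsto_pow_div_factorial_atTop C).eventually
    -- The bound is for the square of the norm, so `1/4` becomes operator norm at most `1/2`. The
    -- condition `n ≥ 1` ensures that `Kⁿz` is a value of the Volterra operator, hence determined by
    -- its restriction to `[0,1]`.
    (gt_mem_nhds (show (0 : ℝ) < 1 / 4 by norm_num)) |>.and (eventually_ge_atTop 1)).exists
  have hnorm : ‖(volterra p) ^ n‖ < 1 := by
    refine lt_of_le_of_lt (ContinuousLinearMap.opNorm_le_bound _ (M := 1 / 2) (by norm_num)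
      fun z => ?_) (by norm_num)
    refine (BoundedContinuousFunction.norm_le (by positivity)).2 fun x => ?_
    have hx : ((volterra p) ^ n) z x = ((volterra p) ^ n) z (clamp x) := by
      obtain ⟨m, rfl⟩ : ∃ m, n = m + 1 := ⟨n - 1, by omega⟩
      rw [pow_succ', mul_apply_eq_comp, volterra_apply_clamp]
    rw [hx]
    refine (le_abs_self _).trans (abs_le_of_sq_le_sq ?_ (by positivity))
    refine (key n z _ (clamp_mem x)).trans ?_
    have : clamp x ^ n ≤ 1 := pow_le_one₀ (clamp_mem x).1 (clamp_mem x).2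
    calc C ^ n * clamp x ^ n / n.factorial * ‖z‖ ^ 2
        ≤ C ^ n * 1 / n.factorial * ‖z‖ ^ 2 := by gcongr
      _ ≤ 1 / 4 * ‖z‖ ^ 2 := by rw [mul_one]; gcongr
      _ = _ := by ring
  have hu := isUnit_one_sub_of_norm_lt_one (R := X →L[ℝ] X) hnorm
  rw [← mul_neg_geom_sum] at hu
  refine ((Commute.isUnit_mul_iff ?_).1 hu).1
  refine Commute.sum_right _ _ _ fun i _ => ?_
  exact (Commute.one_left _).sub_left ((Commute.refl (volterra p)).pow_right i)

/-! ### Solutions of the system in complex form -/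

/-- The solution of `z' = i λ z - i v z̄`, `z(0) = c`, for `p = (v, λ)`. -/
def sol (p : H × ℝ) (c : ℂ) : X :=
  Ring.inverse (1 - volterra p) (BoundedContinuousFunction.const ℝ c)

theorem sol_eq (p : H × ℝ) (c : ℂ) :
    sol p c = BoundedContinuousFunction.const ℝ c + volterra p (sol p c) := by
  have h := Ring.mul_inverse_cancel _ (isUnit_one_sub_volterra p)
  have h2 := congrArg (fun T : X →L[ℝ] X => T (BoundedContinuousFunction.const ℝ c)) h
  simp only [mul_apply_eq_comp, one_apply_eq_self] at h2
  change (1 - volterra p) (sol p c) = _ at h2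
  rw [← h2]
  simp

theorem prim_sol (p : H × ℝ) (c : ℂ) : Prim (sol p c) (rhs p.1 p.2 (sol p c)) := by
  have h := (Prim.const c).add (prim_volterra p (sol p c))
  simp only [zero_add] at h
  refine h.congr (fun x _ => ?_) (EventuallyEq.refl _ _)
  conv_lhs => rw [sol_eq]
  simp

theorem sol_zero (p : H × ℝ) (c : ℂ) : sol p c 0 = c := by
  rw [sol_eq]
  simp [volterra_apply, clamp_of_mem (x := 0) (by simp)]

theorem sol_clamp (p : H × ℝ) (c : ℂ) (x : ℝ) : sol p c (clamp x) = sol p c x := by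
  rw [sol_eq]
  simp [volterra_apply_clamp]

/-! ### Smooth dependence of solutions on the potential and the spectral parameter. -/

theorem contDiff_ringInverse_comp {E R : Type*} [NormedAddCommGroup E] [NormedSpace ℝ E]
    [NormedRing R] [NormedAlgebra ℝ R] [HasSummableGeomSeries R] {f : E → R}
    (hf : ContDiff ℝ 1 f) (hu : ∀ x, IsUnit (f x)) :
    ContDiff ℝ 1 (fun x => Ring.inverse (f x)) := by
  rw [contDiff_iff_contDiffAt]
  intro x
  obtain ⟨u, h⟩ := hu x
  have h2 : ContDiffAt ℝ 1 Ring.inverse (f x) := h ▸ contDiffAt_ringInverse ℝ u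
  exact h2.comp x hf.contDiffAt

theorem contDiff_resolvent_apply {E F : Type*} [NormedAddCommGroup E] [NormedSpace ℝ E]
    [NormedAddCommGroup F] [NormedSpace ℝ F] [CompleteSpace F] (L : E →L[ℝ] F →L[ℝ] F)
    (hu : ∀ x, IsUnit (1 - L x)) (c : F) :
    ContDiff ℝ 1 (fun x => Ring.inverse (1 - L x) c) :=
  (contDiff_ringInverse_comp (contDiff_const.sub L.contDiff) hu).clm_apply contDiff_const

theorem contDiff_sol (c : ℂ) : ContDiff ℝ 1 (fun p => sol p c) :=
  contDiff_resolvent_apply volterra isUnit_one_sub_volterra _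

/-- Differentiation of the fixed point equation `sol_eq`. Since `volterra` is linear in `(v, λ)`,
the source term is `volterra δ` applied to the unperturbed solution. -/
theorem fderiv_sol_eq (c : ℂ) (p δ : H × ℝ) :
    fderiv ℝ (fun p => sol p c) p δ =
      volterra p (fderiv ℝ (fun p => sol p c) p δ) + volterra δ (sol p c) := by
  have hd : HasFDerivAt (fun p => sol p c) (fderiv ℝ (fun p => sol p c) p) p :=
    ((contDiff_sol c).differentiable (by norm_num) p).hasFDerivAt
  have h1 := (volterra.hasFDerivAt (x := p)).clm_apply hd
  have h2 : HasFDerivAt (fun p => sol p c) _ p :=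
    (h1.const_add (BoundedContinuousFunction.const ℝ c)).congr_of_eventuallyEq
      (Eventually.of_forall fun q => sol_eq q c)
  have h3 := congrArg (fun T : (H × ℝ) →L[ℝ] X => T δ) (hd.unique h2)
  simpa using h3

theorem prim_fderiv_sol (c : ℂ) (p δ : H × ℝ) :
    Prim (fderiv ℝ (fun p => sol p c) p δ) (fun t =>
      rhs p.1 p.2 (fderiv ℝ (fun p => sol p c) p δ) t + rhs δ.1 δ.2 (sol p c) t) := by
  refine ((prim_volterra p _).add (prim_volterra δ (sol p c))).congr (fun x _ => ?_)
    (EventuallyEq.refl _ _)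
  conv_lhs => rw [fderiv_sol_eq]
  simp

theorem fderiv_sol_zero (c : ℂ) (p δ : H × ℝ) : fderiv ℝ (fun p => sol p c) p δ 0 = 0 := by
  rw [fderiv_sol_eq]
  simp [volterra_apply, clamp_of_mem (x := 0) (by simp)]

/-- The potential terms cancel in the derivative of `2i Im(z̄w)`, leaving the difference of the
spectral parameters and the source `h`. With `h = 0` and `l = m` this is constancy of the Wronskian;
with `l = m` it is the variation formula; with `h = 0` it yields the wedge identities. -/
theorem Prim.wronskian {v : H} {l m : ℝ} {z w h : ℝ → ℂ} (hz : Prim z (rhs v l z))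
    (hw : Prim w (fun t => rhs v m w t + h t)) :
    Prim (fun x => conj (z x) * w x - z x * conj (w x)) (fun t =>
      Complex.I * (m - l) * (conj (z t) * w t + z t * conj (w t)) +
        (conj (z t) * h t - z t * conj (h t))) := by
  refine ((hz.conjugate.mul hw).sub (hz.mul hw.conjugate)).congr (fun _ _ => rfl)
    (Eventually.of_forall fun t => ?_)
  simp only [rhs, map_add, map_sub, map_mul, Complex.conj_I, Complex.conj_ofReal, Complex.conj_conj]
  ring

theorem conj_mul_sub_eq (z w : ℂ) :
    conj z * w - z * conj w = 2 * (conj z * w).im * Complex.I := by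
  apply Complex.ext <;> simp <;> ring

theorem conj_mul_add_eq (z w : ℂ) : conj z * w + z * conj w = 2 * (conj z * w).re := by
  apply Complex.ext <;> simp <;> ring

theorem wronskian_sol (p : H × ℝ) (x : ℝ) : (conj (sol p 1 x) * sol p Complex.I x).im = 1 := by
  have h1 : Prim (sol p Complex.I) (fun t => rhs p.1 p.2 (sol p Complex.I) t + 0) := by
    simpa using prim_sol p Complex.I
  have h := ((prim_sol p 1).wronskian h1).eq_of_ae_zero
    (Eventually.of_forall fun t => by simp) (clamp x) (clamp_mem x)
  simp only [sol_clamp, sol_zero, conj_mul_sub_eq] at h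
  have := congrArg Complex.im h
  simp at this
  simpa using this

theorem sol_one_ne_zero (p : H × ℝ) (x : ℝ) : sol p 1 x ≠ 0 := by
  intro h
  have := wronskian_sol p x
  simp [h] at this

/-! ### Solutions of the original system -/

theorem mulVec_apply (v : H) (l : ℂ) (t : ℝ) (a : Fin 2 → ℂ) :
    (J * (V v t - l • (1 : Matrix (Fin 2) (Fin 2) ℂ))).mulVec a =
      ![(v.snd t : ℂ) * a 0 - (v.fst t + l) * a 1, (l - v.fst t) * a 0 - v.snd t * a 1] := by
  ext i
  fin_cases i <;>
    simp [J, V, Matrix.mulVec, Matrix.mul_apply, dotProduct, Fin.sum_univ_two] <;> ring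

theorem integrable_fst (v : H) : Integrable (fun t => (v.fst t : ℂ)) unitMeasure :=
  ((Lp.memLp v.fst).integrable (by norm_num)).ofReal

theorem integrable_snd (v : H) : Integrable (fun t => (v.snd t : ℂ)) unitMeasure :=
  ((Lp.memLp v.snd).integrable (by norm_num)).ofReal

theorem integrable_mul_continuousOn {g f : ℝ → ℂ} (hg : Integrable g unitMeasure)
    (hf : ContinuousOn f (Icc 0 1)) : Integrable (fun t => g t * f t) unitMeasure :=
  integrable_of_intervalIntegrable ((intervalIntegrable_of_integrable hg).mul_continuousOn
    (by rwa [uIcc_of_le zero_le_one]))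

/-- `(f₁, f₂)` solves the system, written by components. -/
def IsPairSolution (v : H) (l : ℂ) (f₁ f₂ : ℝ → ℂ) : Prop :=
  Prim f₁ (fun t => (v.snd t : ℂ) * f₁ t - (v.fst t + l) * f₂ t) ∧
  Prim f₂ (fun t => (l - v.fst t) * f₁ t - v.snd t * f₂ t)

theorem isSolution_iff (v : H) (l : ℂ) (f : ℝ → Fin 2 → ℂ) :
    IsSolution v l f ↔ IsPairSolution v l (fun x => f x 0) (fun x => f x 1) := by
  have hfint : ∀ {f : ℝ → Fin 2 → ℂ}, ContinuousOn f (Icc 0 1) →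
      Integrable (fun t => (v.snd t : ℂ) * f t 0 - (v.fst t + l) * f t 1) unitMeasure ∧
      Integrable (fun t => (l - v.fst t) * f t 0 - v.snd t * f t 1) unitMeasure := by
    intro f hf
    have c0 : ContinuousOn (fun t => f t 0) (Icc 0 1) := continuousOn_pi.1 hf 0
    have c1 : ContinuousOn (fun t => f t 1) (Icc 0 1) := continuousOn_pi.1 hf 1
    exact ⟨(integrable_mul_continuousOn (integrable_snd v) c0).sub
        (integrable_mul_continuousOn ((integrable_fst v).add (integrable_const l)) c1),
      (integrable_mul_continuousOn ((integrable_const l).sub (integrable_fst v)) c0).sub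
        (integrable_mul_continuousOn (integrable_snd v) c1)⟩
  have hcomp : ∀ {f : ℝ → Fin 2 → ℂ}, ContinuousOn f (Icc 0 1) → ∀ x ∈ Icc (0 : ℝ) 1,
      (∫ t in (0 : ℝ)..x, (J * (V v t - l • (1 : Matrix (Fin 2) (Fin 2) ℂ))).mulVec (f t)) =
      ![∫ t in (0 : ℝ)..x, ((v.snd t : ℂ) * f t 0 - (v.fst t + l) * f t 1),
        ∫ t in (0 : ℝ)..x, ((l - v.fst t) * f t 0 - v.snd t * f t 1)] := by
    intro f hf x hx
    obtain ⟨i0, i1⟩ := hfint hf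
    simp_rw [mulVec_apply]
    have hi : IntervalIntegrable (fun t => ![(v.snd t : ℂ) * f t 0 - (v.fst t + l) * f t 1,
        (l - v.fst t) * f t 0 - v.snd t * f t 1]) volume 0 x := by
      refine intervalIntegrable_unit (Integrable.of_eval fun i => ?_) hx
      fin_cases i
      · simpa using i0
      · simpa using i1
    ext i
    have := (ContinuousLinearMap.proj (R := ℝ) (φ := fun _ : Fin 2 => ℂ)
      i).intervalIntegral_comp_comm hi
    rw [ContinuousLinearMap.proj_apply] at this
    rw [← this]
    fin_cases i <;> simp
  constructor
  · rintro ⟨hc, h⟩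
    obtain ⟨i0, i1⟩ := hfint hc
    refine ⟨⟨i0, fun x hx => ?_⟩, ⟨i1, fun x hx => ?_⟩⟩
    · have := congrFun (h x hx) 0
      rw [hcomp hc x hx] at this
      simpa using this
    · have := congrFun (h x hx) 1
      rw [hcomp hc x hx] at this
      simpa using this
  · rintro ⟨h0, h1⟩
    have hc : ContinuousOn f (Icc 0 1) := continuousOn_pi.2 fun i => by
      fin_cases i
      · exact h0.continuousOn
      · exact h1.continuousOn
    refine ⟨hc, fun x hx => ?_⟩
    rw [hcomp hc x hx]
    ext i
    fin_cases i
    · simpa using h0.eq x hx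
    · simpa using h1.eq x hx

theorem ofReal_re_eq (z : ℂ) : (z.re : ℂ) = 1 / 2 * (z + conj z) := by
  apply Complex.ext <;> simp <;> ring

theorem ofReal_im_eq (z : ℂ) : (z.im : ℂ) = -Complex.I / 2 * (z - conj z) := by
  apply Complex.ext <;> simp <;> ring

theorem isPairSolution_of_prim {v : H} {l : ℝ} {z : ℝ → ℂ} (h : Prim z (rhs v l z)) :
    IsPairSolution v l (fun x => ((z x).re : ℂ)) (fun x => ((z x).im : ℂ)) := by
  refine ⟨((h.add h.conjugate).const_mul (1 / 2)).congr (fun x _ => ofReal_re_eq _)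
    (Eventually.of_forall fun t => ?_),
    ((h.sub h.conjugate).const_mul (-Complex.I / 2)).congr (fun x _ => ofReal_im_eq _)
    (Eventually.of_forall fun t => ?_)⟩
  · simp only
    rw [← ofReal_re_eq]
    apply Complex.ext <;> simp [rhs, pot] <;> ring
  · simp only
    rw [← ofReal_im_eq]
    apply Complex.ext <;> simp [rhs, pot] <;> ring

theorem IsPairSolution.det_eq {v : H} {l : ℂ} {f₁ f₂ g₁ g₂ : ℝ → ℂ}
    (hf : IsPairSolution v l f₁ f₂) (hg : IsPairSolution v l g₁ g₂) :
    ∀ x ∈ Icc (0 : ℝ) 1, f₁ x * g₂ x - f₂ x * g₁ x = f₁ 0 * g₂ 0 - f₂ 0 * g₁ 0 := by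
  refine ((hf.1.mul hg.2).sub (hf.2.mul hg.1)).eq_of_ae_zero (Eventually.of_forall fun t => ?_)
  simp only [Pi.zero_apply]
  ring

theorem re_mul_im_sub (z w : ℂ) : z.re * w.im - z.im * w.re = (conj z * w).im := by
  simp; ring

/-- Cramer's rule: the determinants of `f` with the two fundamental solutions are constant, and the
two have determinant `1`. This includes uniqueness for the initial value problem at real `l`, for
complex-valued `f`. -/
theorem IsSolution.eq_sol {v : H} {l : ℝ} {f : ℝ → Fin 2 → ℂ} (hf : IsSolution v l f) {x : ℝ}
    (hx : x ∈ Icc (0 : ℝ) 1) :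
    f x = ![f 0 0 * (sol (v, l) 1 x).re + f 0 1 * (sol (v, l) Complex.I x).re,
      f 0 0 * (sol (v, l) 1 x).im + f 0 1 * (sol (v, l) Complex.I x).im] := by
  rw [isSolution_iff] at hf
  have h1 := hf.det_eq (isPairSolution_of_prim (prim_sol (v, l) 1)) x hx
  have h2 := hf.det_eq (isPairSolution_of_prim (prim_sol (v, l) Complex.I)) x hx
  have h3 : ((sol (v, l) 1 x).re : ℂ) * (sol (v, l) Complex.I x).im -
      (sol (v, l) 1 x).im * (sol (v, l) Complex.I x).re = 1 := by
    have := wronskian_sol (v, l) x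
    rw [← re_mul_im_sub] at this
    exact_mod_cast this
  simp only [sol_zero] at h1 h2
  simp at h1 h2
  ext i
  fin_cases i
  · simp
    linear_combination (-f x 0) * h3 + (sol (v, l) 1 x).re * h2 -
      (sol (v, l) Complex.I x).re * h1
  · simp
    linear_combination (-f x 1) * h3 + (sol (v, l) 1 x).im * h2 -
      (sol (v, l) Complex.I x).im * h1

theorem isSolution_sol (v : H) (l : ℝ) (c : ℂ) :
    IsSolution v l (fun x => ![((sol (v, l) c x).re : ℂ), ((sol (v, l) c x).im : ℂ)]) := by
  rw [isSolution_iff]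
  simpa using isPairSolution_of_prim (prim_sol (v, l) c)

theorem theta_one (v : H) (l : ℝ) :
    theta v l 1 = ![((sol (v, l) 1 1).re : ℂ), ((sol (v, l) 1 1).im : ℂ)] := by
  have h : IsSolution v l (theta v l) ∧ theta v l 0 = ![1, 0] := by
    refine Classical.epsilon_spec (p := fun f => IsSolution v l f ∧ f 0 = ![1, 0])
      ⟨_, isSolution_sol v l 1, ?_⟩
    simp [sol_zero]
  rw [h.1.eq_sol (by simp), h.2]
  simp

/-- Rotation by a quarter turn changes the sign of the potential. -/
theorem isSolution_neg_iff (v : H) (l : ℂ) (f : ℝ → Fin 2 → ℂ) :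
    IsSolution v l f ↔ IsSolution (-v) l (fun x => ![f x 1, -f x 0]) := by
  have e : ∀ᵐ t ∂unitMeasure, (-v).fst t = -v.fst t ∧ (-v).snd t = -v.snd t := by
    filter_upwards [Lp.coeFn_neg v.fst, Lp.coeFn_neg v.snd] with t h1 h2
    exact ⟨h1, h2⟩
  rw [isSolution_iff, isSolution_iff]
  simp only [Matrix.cons_val_zero, Matrix.cons_val_one]
  constructor
  · rintro ⟨h1, h2⟩
    refine ⟨h2.congr (fun _ _ => rfl) ?_, (h1.const_mul (-1)).congr (fun _ _ => by simp) ?_⟩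
    · filter_upwards [e] with t ht
      rw [ht.1, ht.2]; push_cast; ring
    · filter_upwards [e] with t ht
      rw [ht.1, ht.2]; push_cast; ring
  · rintro ⟨h1, h2⟩
    refine ⟨(h2.const_mul (-1)).congr (fun _ _ => by simp) ?_, h1.congr (fun _ _ => rfl) ?_⟩
    · filter_upwards [e] with t ht
      rw [ht.1, ht.2]; push_cast; ring
    · filter_upwards [e] with t ht
      rw [ht.1, ht.2]; push_cast; ring

/-- The quarter turn of `isSolution_neg_iff` exchanges the two components, and with them the two
mixed boundary conditions. -/
theorem eigenvalues_neg (v : H) : eigenvalues v 0 1 = eigenvalues (-v) 1 0 := by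
  ext l
  constructor
  · rintro ⟨f, hf, ⟨x, hx, hne⟩, h0, h1⟩
    refine ⟨fun x => ![f x 1, -f x 0], (isSolution_neg_iff v l f).1 hf, ⟨x, hx, fun h => hne ?_⟩,
      by simpa using h0, by simpa using h1⟩
    ext i
    have a := congrFun h 0
    have b := congrFun h 1
    fin_cases i
    · simpa using b
    · simpa using a
  · rintro ⟨f, hf, ⟨x, hx, hne⟩, h0, h1⟩
    refine ⟨fun x => ![-f x 1, f x 0], ?_, ⟨x, hx, fun h => hne ?_⟩,
      by simpa using h0, by simpa using h1⟩
    · rw [isSolution_neg_iff]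
      convert hf using 1
      ext x i
      fin_cases i <;> simp
    · ext i
      have a := congrFun h 0
      have b := congrFun h 1
      fin_cases i
      · simpa using b
      · simpa using a

theorem phi_one_zero (v : H) (l : ℝ) : phi v l 1 0 = -theta (-v) l 1 1 := by
  have h : IsSolution v l (phi v l) ∧ phi v l 0 = ![0, 1] := by
    refine Classical.epsilon_spec (p := fun f => IsSolution v l f ∧ f 0 = ![0, 1])
      ⟨_, isSolution_sol v l Complex.I, ?_⟩
    simp [sol_zero]
  have h2 := ((isSolution_neg_iff v l _).1 h.1).eq_sol (x := 1) (by simp)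
  have h3 := congrFun h2 1
  rw [theta_one]
  simp [h.2] at h3
  simp [← h3]

/-! ### Eigenvalues -/

/-- Lagrange's identity: `f₁f̄₂ - f₂f̄₁` has derivative `(λ̄ - λ)|f|²` and vanishes at both ends by
the boundary conditions. -/
theorem eigenvalue_real {v : H} {i k : Fin 2} {l : ℂ} (h : l ∈ eigenvalues v i k) :
    (l.re : ℂ) = l := by
  obtain ⟨f, hf, ⟨x, hx, hne⟩, h0, h1⟩ := h
  have hc := hf.1
  rw [isSolution_iff] at hf
  have hp := ((hf.1.mul hf.2.conjugate).sub (hf.2.mul hf.1.conjugate)).eq_one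
  have b0 : f 0 0 * conj (f 0 1) - f 0 1 * conj (f 0 0) = 0 := by
    fin_cases i <;> simp_all
  have b1 : f 1 0 * conj (f 1 1) - f 1 1 * conj (f 1 0) = 0 := by
    fin_cases k <;> simp_all
  rw [b0, b1, zero_add] at hp
  have hi : ∫ t, (conj l - l) * ((‖f t 0‖ ^ 2 + ‖f t 1‖ ^ 2 : ℝ) : ℂ) ∂unitMeasure = 0 := by
    rw [hp]
    refine integral_congr_ae (Eventually.of_forall fun t => ?_)
    simp only [map_sub, map_mul, map_add, Complex.conj_ofReal]
    push_cast
    rw [← Complex.mul_conj', ← Complex.mul_conj']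
    ring
  rw [integral_const_mul, mul_eq_zero, integral_complex_ofReal, ← intervalIntegral_eq_integral]
    at hi
  have hpos : 0 < ∫ t in (0 : ℝ)..1, (‖f t 0‖ ^ 2 + ‖f t 1‖ ^ 2) := by
    refine intervalIntegral.integral_pos zero_lt_one ?_ (fun _ _ => by positivity) ⟨x, hx, ?_⟩
    · exact ((continuousOn_pi.1 hc 0).norm.pow 2).add ((continuousOn_pi.1 hc 1).norm.pow 2)
    · by_contra hle
      have a0 : ‖f x 0‖ = 0 := by nlinarith [sq_nonneg ‖f x 0‖, sq_nonneg ‖f x 1‖]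
      have a1 : ‖f x 1‖ = 0 := by nlinarith [sq_nonneg ‖f x 0‖, sq_nonneg ‖f x 1‖]
      refine hne (funext fun j => ?_)
      fin_cases j
      · simpa using a0
      · simpa using a1
  rcases hi with hi | hi
  · rw [sub_eq_zero] at hi
    exact (Complex.conj_eq_iff_real.1 hi).elim fun r hr => by simp [hr]
  · exact absurd (by exact_mod_cast hi) hpos.ne'

/-- The condition `f₂(0) = 0` makes an eigenfunction a nonzero multiple of `ϑ`. By reality of the
eigenvalues only real spectral parameters matter. -/
theorem eigenvalues_one_eq (v : H) (k : Fin 2) : eigenvalues v 1 k =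
    {l | ∃ r : ℝ, (r : ℂ) = l ∧ ![(sol (v, r) 1 1).re, (sol (v, r) 1 1).im] k = 0} := by
  ext l
  constructor
  · intro h
    have hr := eigenvalue_real h
    obtain ⟨f, hf, ⟨x, hx, hne⟩, h0, h1⟩ := h
    refine ⟨l.re, hr, ?_⟩
    rw [← hr] at hf
    have hx' := hf.eq_sol hx
    have h1' := congrFun (hf.eq_sol (x := 1) (by simp)) k
    rw [h1] at h1'
    have hz : f 0 0 ≠ 0 := by
      intro hz
      apply hne
      rw [hx', h0, hz]
      ext i
      fin_cases i <;> simp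
    fin_cases k
    · simpa [h0, hz] using h1'
    · simpa [h0, hz] using h1'
  · rintro ⟨r, rfl, hr⟩
    refine ⟨_, isSolution_sol v r 1, ⟨0, by simp, ?_⟩, by simp [sol_zero], ?_⟩
    · intro h
      have := congrFun h 0
      simp [sol_zero] at this
    · fin_cases k
      · simpa using hr
      · simpa using hr

/-! ### The second solution by rotation -/

theorem volterra_I_smul (v : H) (l : ℝ) (u : X) :
    volterra (v, l) (Complex.I • u) = Complex.I • volterra (-v, l) u := by
  ext x
  rw [BoundedContinuousFunction.smul_apply, volterra_apply, volterra_apply,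
    ← intervalIntegral.integral_smul]
  refine intervalIntegral_congr_unit ?_ (clamp_mem x)
  filter_upwards [pot_neg v] with t ht
  simp only [rhs, ht, BoundedContinuousFunction.coe_smul, smul_eq_mul, map_mul, Complex.conj_I]
  ring

theorem sol_unique {p : H × ℝ} {c : ℂ} {z : X}
    (h : z = BoundedContinuousFunction.const ℝ c + volterra p z) : z = sol p c := by
  have h1 : (1 - volterra p) z = BoundedContinuousFunction.const ℝ c := by
    rw [sub_apply, one_apply_eq_self, sub_eq_iff_eq_add]; exact h
  have h2 := Ring.inverse_mul_cancel _ (isUnit_one_sub_volterra p)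
  have h3 := congrArg (fun T : X →L[ℝ] X => T z) h2
  simp only [mul_apply_eq_comp, one_apply_eq_self, h1] at h3
  exact h3.symm

/-- Conjugation turns `i` into `-i`, so multiplication by `i` changes the sign of the potential.
Every estimate for the solution starting at `1` thus carries over to the one starting at `i`. -/
theorem sol_I_eq (v : H) (l : ℝ) : sol (v, l) Complex.I = Complex.I • sol (-v, l) 1 := by
  refine (sol_unique ?_).symm
  rw [volterra_I_smul]
  conv_lhs => rw [sol_eq]
  ext x
  simp

/-! ### The angle function -/

theorem one_le_norm_mul_norm (p : H × ℝ) (x : ℝ) : 1 ≤ ‖sol p 1 x‖ * ‖sol p Complex.I x‖ := by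
  rw [← wronskian_sol p x]
  refine (Complex.im_le_norm _).trans ?_
  simp

/-- The Wronskian identity gives `1 ≤ |z||y|`, so `1/z` is bounded by `‖y‖`. -/
theorem isUnit_sol (p : H × ℝ) : IsUnit (sol p 1) := by
  let zi : X := BoundedContinuousFunction.ofNormedAddCommGroup (fun x => (sol p 1 x)⁻¹)
    ((sol p 1).continuous.inv₀ (sol_one_ne_zero p)) ‖sol p Complex.I‖ (fun x => by
      have h0 : 0 < ‖sol p 1 x‖ := norm_pos_iff.2 (sol_one_ne_zero p x)
      have h1 := one_le_norm_mul_norm p x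
      have h2 := (sol p Complex.I).norm_coe_le_norm x
      rw [norm_inv, inv_le_iff_one_le_mul₀' h0]
      exact h1.trans (by gcongr))
  refine IsUnit.of_mul_eq_one zi ?_
  ext x
  simp [zi, sol_one_ne_zero p x]

theorem inverse_sol_apply (p : H × ℝ) (x : ℝ) :
    Ring.inverse (sol p 1) x = (sol p 1 x)⁻¹ := by
  have h := congrArg (fun w : X => w x) (Ring.mul_inverse_cancel _ (isUnit_sol p))
  simp at h
  exact eq_inv_of_mul_eq_one_right h

/-- The unimodular function `z / z̄`, where `z` is the solution with `z(0) = 1`. -/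
def phase (p : H × ℝ) : X := sol p 1 * star (Ring.inverse (sol p 1))

theorem phase_apply (p : H × ℝ) (x : ℝ) :
    phase p x = sol p 1 x * conj (sol p 1 x)⁻¹ := by
  simp [phase, inverse_sol_apply]

theorem norm_phase_apply (p : H × ℝ) (x : ℝ) : ‖phase p x‖ = 1 := by
  rw [phase_apply]
  have := norm_pos_iff.2 (sol_one_ne_zero p x)
  simp [this.ne']

theorem contDiff_phase : ContDiff ℝ 1 phase := by
  refine (contDiff_sol 1).mul ?_
  exact (starL' ℝ (A := X)).contDiff.comp (contDiff_ringInverse_comp (contDiff_sol 1) isUnit_sol)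

/-- The logarithm of the solution `z` with `z(0) = 1`. -/
def logSol (p : H × ℝ) (x : ℝ) : ℂ := Complex.I * p.2 * x + volterra (p.1, 0) (phase p) x

/-- The angle of the solution `z` with `z(0) = 1` at the right end point. -/
def ang (p : H × ℝ) : ℝ := p.2 + (volterra (p.1, 0) (phase p) 1).im

theorem prim_logSol (p : H × ℝ) :
    Prim (logSol p) (fun t => Complex.I * p.2 - Complex.I * pot p.1 t * conj (phase p t)) := by
  have h := (Prim.id.const_mul (Complex.I * p.2)).add (prim_volterra (p.1, 0) (phase p))
  refine h.congr (fun x _ => rfl) (Eventually.of_forall fun t => ?_)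
  simp only [rhs, mul_one]
  push_cast; ring

/-- The integrand of `logSol` is `z'/z`, because the conjugate of `phase` is `z̄/z`; hence `z ·
exp(-logSol)` has zero derivative. Integrating `z'/z` fixes a smooth branch of the logarithm. -/
theorem exp_logSol (p : H × ℝ) {x : ℝ} (hx : x ∈ Icc (0 : ℝ) 1) :
    sol p 1 x = Complex.exp (logSol p x) := by
  have h := ((prim_sol p 1).mul ((prim_logSol p).const_mul (-1)).cexp).eq_of_ae_zero
    (Eventually.of_forall fun t => by
      simp only [rhs, phase_apply, map_mul, Complex.conj_conj, Pi.zero_apply]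
      have := sol_one_ne_zero p t
      field_simp
      ring) x hx
  have h0 : logSol p 0 = 0 := by
    simp [logSol, volterra_apply, clamp_of_mem (x := 0) (by simp)]
  simp only [sol_zero, h0, mul_zero, Complex.exp_zero, mul_one, neg_mul, one_mul,
    Complex.exp_neg] at h
  exact eq_of_mul_inv_eq_one h

/-- The phase is unimodular, so the integrand has modulus `|v|`. The bound does not depend on `λ`,
and this is the source of all the uniformity in the spectral parameter. -/
theorem norm_volterra_phase_le (p : H × ℝ) (x : ℝ) :
    ‖volterra (p.1, 0) (phase p) x‖ ≤ ‖p.1‖ := by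
  rw [volterra_apply]
  refine (norm_intervalIntegral_le_unit (integrable_rhs _ _ _) (clamp_mem x)).trans ?_
  refine le_trans (le_of_eq ?_) (integral_norm_pot_le p.1)
  refine integral_congr_ae (Eventually.of_forall fun t => ?_)
  simp [rhs, norm_phase_apply]

theorem re_logSol (p : H × ℝ) (x : ℝ) :
    (logSol p x).re = (volterra (p.1, 0) (phase p) x).re := by
  simp [logSol]

theorem norm_sol_le (p : H × ℝ) (x : ℝ) : ‖sol p 1 x‖ ≤ Real.exp ‖p.1‖ := by
  rw [← sol_clamp, exp_logSol p (clamp_mem x), Complex.norm_exp, re_logSol]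
  gcongr
  exact (Complex.re_le_norm _).trans (norm_volterra_phase_le p _)

theorem le_norm_sol (p : H × ℝ) (x : ℝ) : Real.exp (-‖p.1‖) ≤ ‖sol p 1 x‖ := by
  rw [← sol_clamp, exp_logSol p (clamp_mem x), Complex.norm_exp, re_logSol]
  gcongr
  exact neg_le_of_abs_le ((Complex.abs_re_le_norm _).trans (norm_volterra_phase_le p _))

theorem abs_ang_sub_le (p : H × ℝ) : |ang p - p.2| ≤ ‖p.1‖ := by
  rw [ang, add_sub_cancel_left]
  exact (Complex.abs_im_le_norm _).trans (norm_volterra_phase_le p _)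

theorem im_logSol (p : H × ℝ) : (logSol p 1).im = ang p := by
  simp [logSol, ang]

theorem sol_one_eq (p : H × ℝ) :
    sol p 1 1 = ‖sol p 1 1‖ * Complex.exp (ang p * Complex.I) := by
  have h := exp_logSol p (x := 1) (by simp)
  rw [h, Complex.norm_exp, ← im_logSol, Complex.ofReal_exp, ← Complex.exp_add, Complex.re_add_im]

theorem contDiff_clm_apply₂ {D E F G : Type*} [NormedAddCommGroup D] [NormedSpace ℝ D]
    [NormedAddCommGroup E] [NormedSpace ℝ E] [NormedAddCommGroup F] [NormedSpace ℝ F]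
    [NormedAddCommGroup G] [NormedSpace ℝ G] (L : E →L[ℝ] F →L[ℝ] G) {f : D → E} {g : D → F}
    (hf : ContDiff ℝ 1 f) (hg : ContDiff ℝ 1 g) : ContDiff ℝ 1 (fun x => L (f x) (g x)) :=
  (L.contDiff.comp hf).clm_apply hg

theorem contDiff_volterra_phase :
    ContDiff ℝ 1 (fun p : H × ℝ => volterra (p.1, 0) (phase p)) := by
  have h1 : ContDiff ℝ 1 (fun p : H × ℝ => (p.1, (0 : ℝ))) := contDiff_fst.prodMk contDiff_const
  exact contDiff_clm_apply₂ volterra h1 contDiff_phase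

/-- Evaluation at the right end point. -/
def evalOne : X →L[ℝ] ℂ := BoundedContinuousFunction.evalCLM ℝ (1 : ℝ)

theorem evalOne_apply (z : X) : evalOne z = z 1 := rfl

theorem contDiff_volterra_phase_one :
    ContDiff ℝ 1 (fun p : H × ℝ => volterra (p.1, 0) (phase p) 1) :=
  evalOne.contDiff.comp contDiff_volterra_phase

theorem contDiff_ang : ContDiff ℝ 1 ang :=
  contDiff_snd.add (Complex.imCLM.contDiff.comp contDiff_volterra_phase_one)

theorem contDiff_logSol : ContDiff ℝ 1 (fun p : H × ℝ => logSol p 1) := by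
  have h2 : ContDiff ℝ 1 (fun p : H × ℝ => (p.2 : ℂ)) := Complex.ofRealCLM.contDiff.comp contDiff_snd
  exact ((contDiff_const.mul h2).mul contDiff_const).add contDiff_volterra_phase_one

theorem hasFDerivAt_sol_one (p : H × ℝ) :
    HasFDerivAt (fun p => sol p 1 1) (evalOne.comp (fderiv ℝ (fun p => sol p 1) p)) p :=
  evalOne.hasFDerivAt.comp p ((contDiff_sol 1).differentiable (by norm_num) p).hasFDerivAt

/-- The angle is `Im log z(1)`, so its variation is `Im(ż/z) = Im(z̄ż)/|z|²`. -/
theorem fderiv_ang (p δ : H × ℝ) :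
    fderiv ℝ ang p δ * ‖sol p 1 1‖ ^ 2 =
      (conj (sol p 1 1) * fderiv ℝ (fun p => sol p 1) p δ 1).im := by
  have hL := (contDiff_logSol.differentiable (by norm_num) p).hasFDerivAt
  have h1 : HasFDerivAt (fun p => sol p 1 1) _ p := hL.cexp.congr_of_eventuallyEq
    (Eventually.of_forall fun q => exp_logSol q (by simp))
  have h2 := congrArg (fun T : (H × ℝ) →L[ℝ] ℂ => T δ) (h1.unique (hasFDerivAt_sol_one p))
  have h3 : HasFDerivAt ang _ p := (Complex.imCLM.hasFDerivAt.comp p hL).congr_of_eventuallyEq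
    (Eventually.of_forall fun q => (im_logSol q).symm)
  simp only [smul_apply, ContinuousLinearMap.comp_apply, smul_eq_mul,
    evalOne_apply] at h2
  rw [← h2, ← exp_logSol p (x := 1) (by simp), h3.fderiv, ← mul_assoc, ← Complex.normSq_eq_conj_mul_self,
    Complex.normSq_eq_norm_sq, Complex.im_ofReal_mul]
  simp [mul_comm]

/-! ### Continuous functions as elements of `H` -/

/-- The element of `H` given by the real and imaginary parts of a function. -/
def toH (w : X) : H :=
  WithLp.toLp 2 (MemLp.toLp (fun x => (w x).re) w.memLp.re, MemLp.toLp (fun x => (w x).im) w.memLp.im)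

theorem pot_toH (w : X) : pot (toH w) =ᵐ[unitMeasure] w := by
  filter_upwards [MemLp.coeFn_toLp w.memLp.re, MemLp.coeFn_toLp w.memLp.im] with t h1 h2
  apply Complex.ext
  · rw [pot_re]; exact h1
  · rw [pot_im]; exact h2

theorem inner_toH (w : X) (v : H) :
    inner ℝ (toH w) v = ∫ t, (conj (w t) * pot v t).re ∂unitMeasure := by
  rw [inner_eq_integral]
  refine integral_congr_ae ?_
  filter_upwards [pot_toH w] with t ht
  rw [ht]

theorem X.integrable_mul_pot (w : X) (v : H) :
    Integrable (fun t => w t * pot v t) unitMeasure :=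
  (integrable_pot v).bdd_mul (c := ‖w‖) w.continuous.aestronglyMeasurable
    (Eventually.of_forall w.norm_coe_le_norm)

/-- `∫ |z|²` for the solution `z` with `z(0) = 1`. -/
def nsq (p : H × ℝ) : ℝ := ∫ t, ‖sol p 1 t‖ ^ 2 ∂unitMeasure

/-- `∫ Re (ȳ z)` for the solutions `z`, `y` with `z(0) = 1`, `y(0) = i`. -/
def cross (p : H × ℝ) : ℝ := ∫ t, (conj (sol p Complex.I t) * sol p 1 t).re ∂unitMeasure

/-- The Wronskian of a solution with the variation `ż` of `z`, which vanishes at `0` and is driven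
by `rhs δ.1 δ.2 z`. The case `c = 1` governs the angle, the case `c = i` the norming constant. -/
theorem im_conj_mul_fderiv_sol (p δ : H × ℝ) (c : ℂ) :
    (conj (sol p c 1) * fderiv ℝ (fun p => sol p 1) p δ 1).im =
      δ.2 * ∫ t, (conj (sol p c t) * sol p 1 t).re ∂unitMeasure -
        inner ℝ (toH (sol p c * sol p 1)) δ.1 := by
  have h := ((prim_sol p c).wronskian (prim_fderiv_sol 1 p δ)).eq_one
  rw [fderiv_sol_zero] at h
  simp only [sub_self, mul_zero, zero_mul, map_zero, zero_add] at h
  simp only [conj_mul_sub_eq] at h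
  have hi : Integrable (fun t => (conj (sol p c t) * rhs δ.1 δ.2 (sol p 1) t).im) unitMeasure := by
    have := (integrable_rhs δ.1 δ.2 (sol p 1)).bdd_mul (c := ‖sol p c‖)
      (f := fun t => conj (sol p c t))
      (Complex.continuous_conj.comp (sol p c).continuous).aestronglyMeasurable
      (Eventually.of_forall fun t => by simpa using (sol p c).norm_coe_le_norm t)
    exact this.im
  have h2 : (conj (sol p c 1) * fderiv ℝ (fun p => sol p 1) p δ 1).im =
      ∫ t, (conj (sol p c t) * rhs δ.1 δ.2 (sol p 1) t).im ∂unitMeasure := by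
    have e : ∀ r : ℝ, 2 * (r : ℂ) * Complex.I = ((2 * r : ℝ) : ℂ) * Complex.I := by simp
    simp only [e] at h
    rw [integral_mul_const, integral_complex_ofReal] at h
    have := congrArg Complex.im h
    simp only [Complex.mul_im, Complex.ofReal_re, Complex.I_im, Complex.ofReal_im, Complex.I_re,
      mul_one, mul_zero, add_zero] at this
    rw [integral_const_mul] at this
    simpa using this
  rw [h2, inner_toH, ← integral_const_mul, ← integral_sub]
  · refine integral_congr_ae (Eventually.of_forall fun t => ?_)
    simp [rhs]
    ring
  · have := ((star (sol p c) * sol p 1).integrable).re.const_mul δ.2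
    simpa using this
  · have := (X.integrable_mul_pot (star (sol p c * sol p 1)) δ.1).re
    simpa using this

theorem im_conj_mul_fderiv_sol_one (p δ : H × ℝ) :
    (conj (sol p 1 1) * fderiv ℝ (fun p => sol p 1) p δ 1).im =
      δ.2 * nsq p - inner ℝ (toH (sol p 1 * sol p 1)) δ.1 := by
  rw [im_conj_mul_fderiv_sol, nsq]
  congr 2
  refine integral_congr_ae (Eventually.of_forall fun t => ?_)
  simp only
  rw [← Complex.normSq_eq_conj_mul_self, Complex.normSq_eq_norm_sq, Complex.ofReal_re]

theorem nsq_pos (p : H × ℝ) : 0 < nsq p := by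
  have h : ∫ _, Real.exp (-‖p.1‖) ^ 2 ∂unitMeasure ≤ nsq p := by
    refine integral_mono (integrable_const _) (sol p 1).memLp.norm.integrable_sq fun t => ?_
    have := le_norm_sol p t
    simp only
    gcongr
  refine lt_of_lt_of_le ?_ h
  simp
  positivity

/-! ### The eigenvalues as functions of the potential -/

theorem fderiv_ang_pos (p : H × ℝ) : 0 < fderiv ℝ ang p (0, 1) := by
  have h := fderiv_ang p (0, 1)
  rw [im_conj_mul_fderiv_sol_one] at h
  simp only [one_mul, inner_zero_right, sub_zero] at h
  have h1 := nsq_pos p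
  have h2 : 0 < ‖sol p 1 1‖ := norm_pos_iff.2 (sol_one_ne_zero p 1)
  rw [← h] at h1
  exact pos_of_mul_pos_left h1 (by positivity)

theorem strictMono_ang (v : H) : StrictMono (fun l => ang (v, l)) := by
  refine strictMono_of_deriv_pos fun l => ?_
  have h1 : HasFDerivAt ang (fderiv ℝ ang (v, l)) (v, l) :=
    (contDiff_ang.differentiable (by norm_num) _).hasFDerivAt
  have h2 : HasDerivAt (fun l : ℝ => (v, l)) ((0 : H), (1 : ℝ)) l :=
    (hasDerivAt_const l v).prodMk (hasDerivAt_id l)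
  have h3 := h1.comp_hasDerivAt l h2
  have h4 := h3.deriv
  simp only [Function.comp_def] at h4
  rw [h4]
  exact fderiv_ang_pos _

theorem surjective_ang (v : H) : Function.Surjective (fun l => ang (v, l)) := by
  have hc : Continuous (fun l => ang (v, l)) :=
    contDiff_ang.continuous.comp (by fun_prop)
  have hb : ∀ l : ℝ, |ang (v, l) - l| ≤ ‖v‖ := fun l => abs_ang_sub_le (v, l)
  refine hc.surjective ?_ ?_
  · refine tendsto_atTop_mono (fun l => ?_) (tendsto_atTop_add_const_right _ (-‖v‖) tendsto_id)
    have := abs_le.1 (hb l)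
    simp only [id]
    linarith
  · refine tendsto_atBot_mono (fun l => ?_) (tendsto_atBot_add_const_right _ ‖v‖ tendsto_id)
    have := abs_le.1 (hb l)
    simp only [id]
    linarith

/-- The value of the spectral parameter for which the angle at the right end point is `c`. -/
def ev (c : ℝ) (v : H) : ℝ := (surjective_ang v c).choose

theorem ang_ev (c : ℝ) (v : H) : ang (v, ev c v) = c := (surjective_ang v c).choose_spec

theorem eq_ev {c l : ℝ} {v : H} (h : ang (v, l) = c) : l = ev c v :=
  (strictMono_ang v).injective (h.trans (ang_ev c v).symm)

theorem differentiableAt_ev (c : ℝ) (v : H) : DifferentiableAt ℝ (ev c) v := by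
  have hc : ContDiffAt ℝ 1 ang (v, ev c v) := contDiff_ang.contDiffAt
  have hne := (fderiv_ang_pos (v, ev c v)).ne'
  have hinv : (fderiv ℝ ang (v, ev c v) ∘L .inr ℝ H ℝ).IsInvertible := by
    refine ⟨ContinuousLinearEquiv.unitsEquivAut ℝ (Units.mk0 _ hne), ?_⟩
    ext
    simp
  have h1 := hc.eventually_apply_implicitFunction one_ne_zero hinv
  have h2 := hc.hasStrictFDerivAt_implicitFunction one_ne_zero hinv
  refine h2.hasFDerivAt.differentiableAt.congr_of_eventuallyEq ?_
  -- The local implicit function agrees with `ev c`, since the angle determines the spectral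
  -- parameter uniquely.
  filter_upwards [h1] with w hw
  rw [ang_ev] at hw
  exact (eq_ev hw).symm

/-- The gradient of `ev c`. -/
def evGrad (c : ℝ) (v : H) : H :=
  (nsq (v, ev c v))⁻¹ • toH (sol (v, ev c v) 1 * sol (v, ev c v) 1)

theorem hasFDerivAt_graph (c : ℝ) (v : H) : HasFDerivAt (fun w => (w, ev c w))
    ((ContinuousLinearMap.id ℝ H).prod (fderiv ℝ (ev c) v)) v :=
  (hasFDerivAt_id v).prodMk (differentiableAt_ev c v).hasFDerivAt

theorem variation_eq_zero (c : ℝ) (v δ : H) :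
    fderiv ℝ ang (v, ev c v) (δ, fderiv ℝ (ev c) v δ) = 0 := by
  have h1 : HasFDerivAt ang (fderiv ℝ ang (v, ev c v)) (v, ev c v) :=
    (contDiff_ang.differentiable (by norm_num) _).hasFDerivAt
  have h2 := h1.comp v (hasFDerivAt_graph c v)
  have h3 : HasFDerivAt (ang ∘ fun w => (w, ev c w)) (0 : H →L[ℝ] ℝ) v :=
    (hasFDerivAt_const c v).congr_of_eventuallyEq (Eventually.of_forall fun w => ang_ev c w)
  have h4 := congrArg (fun T : H →L[ℝ] ℝ => T δ) (h2.unique h3)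
  simpa using h4

/-- Along the graph of `ev c` the angle is constant, so the variation formula reads `0 = λ̇ ∫|z|² -
⟨z², δ⟩`. -/
theorem hasGradientAt_ev (c : ℝ) (v : H) : HasGradientAt (ev c) (evGrad c v) v := by
  rw [hasGradientAt_iff_hasFDerivAt]
  refine (differentiableAt_ev c v).hasFDerivAt.congr_fderiv ?_
  ext δ
  have h1 := fderiv_ang (v, ev c v) (δ, fderiv ℝ (ev c) v δ)
  rw [variation_eq_zero, im_conj_mul_fderiv_sol_one] at h1
  have h2 := nsq_pos (v, ev c v)
  rw [InnerProductSpace.toDual_apply_apply, evGrad, real_inner_smul_left]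
  simp only [zero_mul] at h1
  field_simp
  linarith

/-! ### The norming constants -/

/-- The norming constant belonging to `ev c`. -/
def kap (c : ℝ) (v : H) : ℝ := -Real.log ‖sol (v, ev c v) 1 1‖

/-- The gradient of `kap c`. -/
def kapGrad (c : ℝ) (v : H) : H :=
  cross (v, ev c v) • evGrad c v - toH (sol (v, ev c v) 1 * sol (v, ev c v) Complex.I)

/-- Since `Im(z̄d) = 0`, the number `d` is a real multiple `s z`, and `Im(ȳd) = s Im(ȳz) = -s`. This
converts the variation of `|z(1)|` at a fixed angle into a Wronskian with `y`. -/
theorem re_div_eq {z y d : ℂ} (h1 : (conj z * y).im = 1) (h2 : (conj z * d).im = 0) :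
    (conj z * d).re = -(conj y * d).im * ‖z‖ ^ 2 := by
  have h3 : (conj y * d).im * ‖z‖ ^ 2 = ((conj y * z) * (conj z * d)).im := by
    have : (conj y * z) * (conj z * d) = (conj y * d) * ((‖z‖ ^ 2 : ℝ) : ℂ) := by
      push_cast
      rw [← Complex.mul_conj']
      ring
    rw [this, Complex.im_mul_ofReal]
  have h4 : (conj y * z).im = -1 := by
    rw [← h1]; simp; ring
  rw [neg_mul, h3, Complex.mul_im, h2, h4]
  ring

/-- The variation of `-log|z|` is `-Re(z̄ż)/|z|²`, which by `re_div_eq` equals `Im(ȳż) = λ̇ ∫Re(ȳz)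
- ⟨zy, δ⟩`. -/
theorem hasGradientAt_kap (c : ℝ) (v : H) : HasGradientAt (kap c) (kapGrad c v) v := by
  rw [hasGradientAt_iff_hasFDerivAt]
  set p := (v, ev c v) with hp
  have hg := (hasFDerivAt_sol_one p).comp v (hasFDerivAt_graph c v)
  have hz : ‖sol p 1 1‖ ^ 2 ≠ 0 := by
    have := norm_pos_iff.2 (sol_one_ne_zero p 1)
    positivity
  have hk := ((hg.norm_sq.log hz).const_mul (-(1 / 2) : ℝ))
  refine (hk.congr_of_eventuallyEq (f₁ := kap c) (Eventually.of_forall fun w => by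
    simp [kap, Real.log_pow])).congr_fderiv ?_
  ext δ
  have e1 := fderiv_ang p (δ, fderiv ℝ (ev c) v δ)
  rw [variation_eq_zero, zero_mul] at e1
  have e2 := im_conj_mul_fderiv_sol p (δ, fderiv ℝ (ev c) v δ) Complex.I
  have e3 := re_div_eq (wronskian_sol p 1) e1.symm
  have e4 : fderiv ℝ (ev c) v δ = inner ℝ (evGrad c v) δ := (hasGradientAt_ev c v).fderiv_apply
  rw [InnerProductSpace.toDual_apply_apply, kapGrad, inner_sub_left, real_inner_smul_left]
  rw [← hp, cross, ← e4, mul_comm (sol p 1), mul_comm (∫ _, _ ∂_), ← e2]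
  simp only [smul_apply, ContinuousLinearMap.comp_apply, smul_eq_mul, innerSL_apply_apply,
    ContinuousLinearMap.prod_apply, ContinuousLinearMap.id_apply, evalOne_apply, nsmul_eq_mul]
  have e5 : ((fun p => sol p 1 1) ∘ fun w => (w, ev c w)) v = sol p 1 1 := rfl
  have hz1 : ‖sol p 1 1‖ ≠ 0 := norm_ne_zero_iff.2 (sol_one_ne_zero p 1)
  rw [e5, Complex.inner, mul_comm _ (conj _), e3]
  push_cast
  field_simp

/-! ### The symplectic form -/

theorem wedge_antisymm (f g : H) : wedge f g = -wedge g f := by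
  rw [wedge, wedge, ← integral_neg]
  congr 1; ext x; ring

theorem wedge_self (f : H) : wedge f f = 0 := by
  have := wedge_antisymm f f
  linarith

/-- Multiplication by `i`. -/
def rotH (f : H) : H := WithLp.toLp 2 (-f.snd, f.fst)

theorem wedge_eq_inner (f g : H) : wedge f g = inner ℝ (rotH f) g := by
  rw [wedge_eq_integral, inner_eq_integral]
  refine integral_congr_ae ?_
  filter_upwards [Lp.coeFn_neg f.snd] with t ht
  have e1 : (rotH f).fst t = -f.snd t := ht
  have e2 : (rotH f).snd t = f.fst t := rfl
  simp [pot, e1, e2]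
  ring

theorem wedge_sub_right (f g h : H) : wedge f (g - h) = wedge f g - wedge f h := by
  simp [wedge_eq_inner, inner_sub_right]

theorem wedge_smul_right (f g : H) (r : ℝ) : wedge f (r • g) = r * wedge f g := by
  rw [wedge_eq_inner, wedge_eq_inner, real_inner_smul_right]

theorem wedge_sub_left (f g h : H) : wedge (f - g) h = wedge f h - wedge g h := by
  rw [wedge_antisymm, wedge_sub_right, wedge_antisymm h f, wedge_antisymm h g]; ring

theorem wedge_smul_left (f g : H) (r : ℝ) : wedge (r • f) g = r * wedge f g := by
  rw [wedge_antisymm, wedge_smul_right, wedge_antisymm g f]; ring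

theorem wedge_toH (w u : X) : wedge (toH w) (toH u) = ∫ t, (conj (w t) * u t).im ∂unitMeasure := by
  rw [wedge_eq_integral]
  refine integral_congr_ae ?_
  filter_upwards [pot_toH w, pot_toH u] with t h1 h2
  rw [h1, h2]

/-- The Wronskian `Im(z̄w)` has derivative `(m - l) Re(z̄w)`. The derivative of a product of two
Wronskians is therefore `(m - l)` times the imaginary part of a product, which is the integrand of
the wedge. -/
theorem wedge_sol (v : H) (l m : ℝ) (a b c d : ℂ) :
    (m - l) * wedge (toH (sol (v, l) a * sol (v, l) b)) (toH (sol (v, m) c * sol (v, m) d)) =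
      (conj (sol (v, l) a 1) * sol (v, m) c 1).im * (conj (sol (v, l) b 1) * sol (v, m) d 1).im -
      (conj a * c).im * (conj b * d).im := by
  have hw : ∀ a c : ℂ, Prim (fun x => ((conj (sol (v, l) a x) * sol (v, m) c x).im : ℂ))
      (fun t => (m - l) * ((conj (sol (v, l) a t) * sol (v, m) c t).re : ℂ)) := by
    intro a c
    have h1 : Prim (sol (v, m) c) (fun t => rhs v m (sol (v, m) c) t + 0) := by
      simpa using prim_sol (v, m) c
    refine (((prim_sol (v, l) a).wronskian h1).const_mul (-Complex.I / 2)).congr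
      (fun x _ => ?_) (Eventually.of_forall fun t => ?_)
    · rw [conj_mul_sub_eq]
      linear_combination ((conj (sol (v, l) a x) * sol (v, m) c x).im : ℂ) * Complex.I_sq
    · simp only [conj_mul_add_eq, map_zero]
      linear_combination ((conj (sol (v, l) a t) * sol (v, m) c t).re : ℂ) * (m - l) * Complex.I_sq
  have h := ((hw a c).mul (hw b d)).eq_one
  simp only [sol_zero] at h
  have e : ∀ t, (m - l) * ((conj (sol (v, l) a t) * sol (v, m) c t).re : ℂ) *
      ((conj (sol (v, l) b t) * sol (v, m) d t).im : ℂ) +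
      ((conj (sol (v, l) a t) * sol (v, m) c t).im : ℂ) *
      ((m - l) * ((conj (sol (v, l) b t) * sol (v, m) d t).re : ℂ)) =
      (((m - l) * (conj ((sol (v, l) a * sol (v, l) b) t) *
        (sol (v, m) c * sol (v, m) d) t).im : ℝ) : ℂ) := by
    intro t
    have e2 : conj ((sol (v, l) a * sol (v, l) b) t) * (sol (v, m) c * sol (v, m) d) t =
        (conj (sol (v, l) a t) * sol (v, m) c t) * (conj (sol (v, l) b t) * sol (v, m) d t) := by
      simp; ring
    rw [e2, Complex.mul_im (conj _ * _) (conj _ * _)]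
    push_cast; ring
  simp only [e] at h
  rw [integral_complex_ofReal, integral_const_mul, ← wedge_toH] at h
  have h' : ((conj (sol (v, l) a 1) * sol (v, m) c 1).im *
      (conj (sol (v, l) b 1) * sol (v, m) d 1).im : ℝ) = (conj a * c).im * (conj b * d).im +
      (m - l) * wedge (toH (sol (v, l) a * sol (v, l) b)) (toH (sol (v, m) c * sol (v, m) d)) := by
    exact_mod_cast h
  linarith

/-- Both products contain the solution starting at `1`. The corresponding Wronskian vanishes at `0`,
and at `1` because the two angles differ by a multiple of `π`; the spectral parameters are distinct
because the angles are. -/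
theorem wedge_sol_ev {c c' : ℝ} (hcc : c ≠ c') (hs : Real.sin (c' - c) = 0) (v : H) (b d : ℂ) :
    wedge (toH (sol (v, ev c v) 1 * sol (v, ev c v) b))
      (toH (sol (v, ev c' v) 1 * sol (v, ev c' v) d)) = 0 := by
  have h := wedge_sol v (ev c v) (ev c' v) 1 b 1 d
  have h1 : (conj (sol (v, ev c v) 1 1) * sol (v, ev c' v) 1 1).im = 0 := by
    rw [sol_one_eq (v, ev c v), sol_one_eq (v, ev c' v), ang_ev, ang_ev, map_mul,
      Complex.conj_ofReal, ← Complex.exp_conj, map_mul, Complex.conj_I, Complex.conj_ofReal]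
    have : ∀ r s : ℝ, (r : ℂ) * Complex.exp (c * -Complex.I) * (s * Complex.exp (c' * Complex.I)) =
        ((r * s : ℝ) : ℂ) * Complex.exp (((c' - c : ℝ) : ℂ) * Complex.I) := by
      intro r s
      have : ((c' - c : ℝ) : ℂ) * Complex.I = c * -Complex.I + c' * Complex.I := by push_cast; ring
      rw [this, Complex.exp_add]
      push_cast; ring
    rw [this, Complex.im_ofReal_mul, Complex.exp_ofReal_mul_I_im, hs, mul_zero]
  rw [h1] at h
  simp only [zero_mul, map_one, mul_one, Complex.one_im, sub_self, mul_eq_zero] at h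
  refine h.resolve_left fun h0 => hcc ?_
  rw [← ang_ev c v, ← ang_ev c' v, sub_eq_zero.1 h0]

theorem wedge_sol_self (p : H × ℝ) :
    wedge (toH (sol p 1 * sol p Complex.I)) (toH (sol p 1 * sol p 1)) = -nsq p := by
  rw [wedge_toH, nsq, ← integral_neg]
  refine integral_congr_ae (Eventually.of_forall fun t => ?_)
  have h := wronskian_sol p t
  have e : conj ((sol p 1 * sol p Complex.I) t) * (sol p 1 * sol p 1) t =
      ((‖sol p 1 t‖ ^ 2 : ℝ) : ℂ) * conj (conj (sol p 1 t) * sol p Complex.I t) := by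
    push_cast
    rw [← Complex.mul_conj']
    simp; ring
  simp only
  rw [e, Complex.im_ofReal_mul, Complex.conj_im, h]
  ring

theorem wedge_evGrad_evGrad {c c' : ℝ} (hs : Real.sin (c' - c) = 0) (v : H) :
    wedge (evGrad c v) (evGrad c' v) = 0 := by
  rcases eq_or_ne c c' with rfl | hcc
  · exact wedge_self _
  · rw [evGrad, evGrad, wedge_smul_left, wedge_smul_right, wedge_sol_ev hcc hs]
    simp

theorem wedge_kapGrad_evGrad {c c' : ℝ} (hs : Real.sin (c' - c) = 0) (v : H) :
    wedge (kapGrad c v) (evGrad c' v) = if c = c' then 1 else 0 := by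
  rw [kapGrad, wedge_sub_left, wedge_smul_left, wedge_evGrad_evGrad hs, mul_zero, zero_sub,
    evGrad, wedge_smul_right]
  split_ifs with hcc
  · subst hcc
    rw [wedge_sol_self]
    have := (nsq_pos (v, ev c v)).ne'
    field_simp
  · rw [wedge_sol_ev hcc hs]
    simp

theorem wedge_kapGrad_kapGrad {c c' : ℝ} (hs : Real.sin (c' - c) = 0) (v : H) :
    wedge (kapGrad c v) (kapGrad c' v) = 0 := by
  rcases eq_or_ne c c' with rfl | hcc
  · exact wedge_self _
  · simp [kapGrad, evGrad, wedge_sub_left, wedge_smul_left, wedge_sub_right, wedge_smul_right,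
      wedge_sol_ev hcc hs]

/-! ### Oscillatory integrals of the potential -/

theorem integrable_pot_mul_exp (v : H) (l : ℝ) :
    Integrable (fun t => pot v t * Complex.exp (-2 * Complex.I * l * t)) unitMeasure := by
  refine (integrable_pot v).mul_bdd (c := 1) ?_ (Eventually.of_forall fun t => ?_)
  · exact Continuous.aestronglyMeasurable (by fun_prop)
  · rw [Complex.norm_exp]
    simp

/-- `∫₀ˣ v(t) e^{-2iλt} dt`. -/
def osc (v : H) (l : ℝ) : X := primB _ (integrable_pot_mul_exp v l)

theorem osc_zero (v : H) (l : ℝ) : osc v l 0 = 0 := by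
  simp [osc, primB_apply, clamp_of_mem (x := 0) (by simp)]

theorem prim_osc (v : H) (l : ℝ) :
    Prim (osc v l) (fun t => pot v t * Complex.exp (-2 * Complex.I * l * t)) := by
  refine ⟨integrable_pot_mul_exp v l, fun x hx => ?_⟩
  rw [osc_zero, zero_add, osc, primB_apply, clamp_of_mem hx]

theorem norm_osc_neg (v : H) (l x : ℝ) : ‖osc (-v) l x‖ = ‖osc v l x‖ := by
  rw [← norm_neg, osc, osc, primB_apply, primB_apply, ← intervalIntegral.integral_neg]
  congr 1
  refine intervalIntegral_congr_unit ?_ (clamp_mem x)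
  filter_upwards [pot_neg v] with t ht
  rw [ht]; ring

/-- The `L²` norm of `osc`. -/
def oscNorm (v : H) (l : ℝ) : ℝ := √(∫ t, ‖osc v l t‖ ^ 2 ∂unitMeasure)

theorem oscNorm_nonneg (v : H) (l : ℝ) : 0 ≤ oscNorm v l := Real.sqrt_nonneg _

theorem oscNorm_sq (v : H) (l : ℝ) : oscNorm v l ^ 2 = ∫ t, ‖osc v l t‖ ^ 2 ∂unitMeasure :=
  Real.sq_sqrt (integral_nonneg fun _ => sq_nonneg _)

theorem oscNorm_neg (v : H) (l : ℝ) : oscNorm (-v) l = oscNorm v l := by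
  simp [oscNorm, norm_osc_neg]

theorem integral_norm_osc_le (v : H) (l : ℝ) : ∫ t, ‖osc v l t‖ ∂unitMeasure ≤ oscNorm v l := by
  have h := sq_integral_mul_le (osc v l).memLp.norm (memLp_const (1 : ℝ)) (fun _ => norm_nonneg _)
    (fun _ => zero_le_one)
  refine (le_abs_self _).trans (abs_le_of_sq_le_sq ?_ (oscNorm_nonneg v l))
  rw [oscNorm_sq]
  simpa using h

theorem norm_exp_mul_I (r x : ℝ) : ‖Complex.exp (-Complex.I * r * x)‖ = 1 := by
  rw [Complex.norm_exp]; simp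

theorem prim_exp (a : ℂ) : Prim (fun x => Complex.exp (a * x)) (fun x => a * Complex.exp (a * x)) := by
  simpa using (Prim.id.const_mul a).cexp

/-- Integration by parts against `e^{-2idt}`. It allows oscillatory integrals at a perturbed
eigenvalue to be replaced by those at its asymptotic node. -/
theorem norm_osc_add_le (v : H) (c d : ℝ) {x : ℝ} (hx : x ∈ Icc (0 : ℝ) 1) :
    ‖osc v (c + d) x‖ ≤ ‖osc v c x‖ + 2 * |d| * oscNorm v c := by
  have hn : ∀ t : ℝ, ‖Complex.exp (-2 * Complex.I * d * t)‖ = 1 := fun t => by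
    rw [Complex.norm_exp]; simp
  have h := ((prim_osc v c).mul (prim_exp (-2 * Complex.I * d))).sub (prim_osc v (c + d))
  have h2 := h.norm_sub_le hx
  simp only [osc_zero, zero_mul, sub_zero] at h2
  have h3 : ∫ t, ‖pot v t * Complex.exp (-2 * Complex.I * c * t) * Complex.exp (-2 * Complex.I * d * t) +
      osc v c t * (-2 * Complex.I * d * Complex.exp (-2 * Complex.I * d * t)) -
      pot v t * Complex.exp (-2 * Complex.I * ((c + d : ℝ) : ℂ) * t)‖ ∂unitMeasure ≤
      2 * |d| * oscNorm v c := by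
    calc _ = ∫ t, 2 * |d| * ‖osc v c t‖ ∂unitMeasure := by
          refine integral_congr_ae (Eventually.of_forall fun t => ?_)
          have : Complex.exp (-2 * Complex.I * ((c + d : ℝ) : ℂ) * t) =
            Complex.exp (-2 * Complex.I * c * t) * Complex.exp (-2 * Complex.I * d * t) := by
            rw [← Complex.exp_add]; congr 1; push_cast; ring
          simp only [this]
          have e : pot v t * Complex.exp (-2 * Complex.I * c * t) *
              Complex.exp (-2 * Complex.I * d * t) +
              osc v c t * (-2 * Complex.I * d * Complex.exp (-2 * Complex.I * d * t)) -
              pot v t * (Complex.exp (-2 * Complex.I * c * t) *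
              Complex.exp (-2 * Complex.I * d * t)) =
              osc v c t * (-2 * Complex.I * d * Complex.exp (-2 * Complex.I * d * t)) := by ring
          rw [e, norm_mul, norm_mul, hn]
          simp; ring
      _ ≤ _ := by
          rw [integral_const_mul]
          exact mul_le_mul_of_nonneg_left (integral_norm_osc_le v c) (by positivity)
  have h4 := h2.trans h3
  calc ‖osc v (c + d) x‖ = ‖osc v c x * Complex.exp (-2 * Complex.I * d * x) -
        (osc v c x * Complex.exp (-2 * Complex.I * d * x) - osc v (c + d) x)‖ := by
          congr 1; ring
    _ ≤ ‖osc v c x * Complex.exp (-2 * Complex.I * d * x)‖ + 2 * |d| * oscNorm v c :=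
        (_root_.norm_sub_le _ _).trans (by gcongr)
    _ = _ := by rw [norm_mul, hn, mul_one]

theorem oscNorm_add_le (v : H) {c d B : ℝ} (hd : |d| ≤ B) :
    oscNorm v (c + d) ≤ (2 + 3 * B) * oscNorm v c := by
  have hB : 0 ≤ B := (abs_nonneg d).trans hd
  have hN := oscNorm_nonneg v c
  refine (le_abs_self _).trans (abs_le_of_sq_le_sq ?_ (by positivity))
  rw [oscNorm_sq]
  have h : ∫ t, ‖osc v (c + d) t‖ ^ 2 ∂unitMeasure ≤
      ∫ t, (2 * ‖osc v c t‖ ^ 2 + 8 * B ^ 2 * oscNorm v c ^ 2) ∂unitMeasure := by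
    refine integral_mono_ae (osc v (c + d)).memLp.norm.integrable_sq
      (((osc v c).memLp.norm.integrable_sq.const_mul 2).add (integrable_const _)) ?_
    refine (ae_restrict_mem measurableSet_Ioo).mono fun t ht => ?_
    have h1 := norm_osc_add_le v c d (x := t) ⟨ht.1.le, ht.2.le⟩
    have h2 : 2 * |d| * oscNorm v c ≤ 2 * B * oscNorm v c := by gcongr
    have h3 := norm_nonneg (osc v (c + d) t)
    have h4 : ‖osc v (c + d) t‖ ^ 2 ≤ (‖osc v c t‖ + 2 * B * oscNorm v c) ^ 2 := by
      gcongr; linarith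
    simp only
    -- The inequality `(a + b)² ≤ 2a² + 2b²`; after integration the factor is `2 + 8B² ≤ (2 + 3B)²`.
    nlinarith [sq_nonneg (‖osc v c t‖ - 2 * B * oscNorm v c)]
  refine h.trans ?_
  rw [integral_add ((osc v c).memLp.norm.integrable_sq.const_mul 2) (integrable_const _),
    integral_const_mul, ← oscNorm_sq]
  simp
  have : 0 ≤ B * oscNorm v c ^ 2 := by positivity
  nlinarith [sq_nonneg (B * oscNorm v c), sq_nonneg (oscNorm v c)]

/-! ### Asymptotics of the solutions -/

/-- Removing the free oscillation, `ζ = e^{-iλx}z` satisfies `ζ' = -i v e^{-2iλx} ζ̄`: the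
conjugation doubles the phase. -/
theorem prim_exp_mul_sol (v : H) (l : ℝ) :
    Prim (fun x => Complex.exp (-Complex.I * l * x) * sol (v, l) 1 x) (fun t =>
      -Complex.I * (pot v t * Complex.exp (-2 * Complex.I * l * t)) *
        conj (Complex.exp (-Complex.I * l * t) * sol (v, l) 1 t)) := by
  refine ((prim_exp (-Complex.I * l)).mul (prim_sol (v, l) 1)).congr (fun _ _ => rfl)
    (Eventually.of_forall fun t => ?_)
  have e : Complex.exp (-2 * Complex.I * l * t) * conj (Complex.exp (-Complex.I * l * t)) =
      Complex.exp (-Complex.I * l * t) := by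
    rw [← Complex.exp_conj, ← Complex.exp_add]
    congr 1
    simp; ring
  simp only [rhs, map_mul]
  linear_combination (-Complex.I * pot v t * conj (sol (v, l) 1 t)) * e

/-- One integration by parts: `ζ + i · osc · ζ̄` has derivative `i · osc` times the conjugate of
`ζ'`, whose modulus is at most `e^{‖v‖} |v| |osc|`. -/
theorem norm_exp_mul_sol_sub_le (v : H) (l : ℝ) {x : ℝ} (hx : x ∈ Icc (0 : ℝ) 1) :
    ‖Complex.exp (-Complex.I * l * x) * sol (v, l) 1 x - 1‖ ≤
      Real.exp ‖v‖ * (‖osc v l x‖ + ‖v‖ * oscNorm v l) := by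
  have hn : ∀ t : ℝ, ‖Complex.exp (-2 * Complex.I * l * t)‖ = 1 := fun t => by
    rw [Complex.norm_exp]; simp
  set ζ : ℝ → ℂ := fun x => Complex.exp (-Complex.I * l * x) * sol (v, l) 1 x with hζ
  have hζn : ∀ t, ‖ζ t‖ ≤ Real.exp ‖v‖ := fun t => by
    simp only [hζ, norm_mul, norm_exp_mul_I, one_mul]
    exact norm_sol_le (v, l) t
  have hζp : Prim ζ (fun t => -Complex.I * (pot v t * Complex.exp (-2 * Complex.I * l * t)) *
      conj (ζ t)) := prim_exp_mul_sol v l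
  have hp := hζp.add (((prim_osc v l).mul hζp.conjugate).const_mul Complex.I)
  have h1 := hp.norm_sub_le hx
  have h0 : ζ 0 = 1 := by simp [hζ, sol_zero]
  simp only [osc_zero, zero_mul, mul_zero, add_zero, h0] at h1
  have h2 : ∫ t, ‖-Complex.I * (pot v t * Complex.exp (-2 * Complex.I * l * t)) * conj (ζ t) +
      Complex.I * (pot v t * Complex.exp (-2 * Complex.I * l * t) * conj (ζ t) +
        osc v l t * conj (-Complex.I * (pot v t * Complex.exp (-2 * Complex.I * l * t)) *
          conj (ζ t)))‖ ∂unitMeasure ≤ Real.exp ‖v‖ * (‖v‖ * oscNorm v l) := by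
    have hi : Integrable (fun t => ‖pot v t‖ * ‖osc v l t‖) unitMeasure :=
      (memLp_pot v).norm.integrable_mul (osc v l).memLp.norm
    calc _ ≤ ∫ t, Real.exp ‖v‖ * (‖pot v t‖ * ‖osc v l t‖) ∂unitMeasure := by
          refine integral_mono hp.int.norm (hi.const_mul _) fun t => ?_
          have e : -Complex.I * (pot v t * Complex.exp (-2 * Complex.I * l * t)) * conj (ζ t) +
              Complex.I * (pot v t * Complex.exp (-2 * Complex.I * l * t) * conj (ζ t) +
              osc v l t * conj (-Complex.I * (pot v t * Complex.exp (-2 * Complex.I * l * t)) *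
              conj (ζ t))) = Complex.I * osc v l t *
              conj (-Complex.I * (pot v t * Complex.exp (-2 * Complex.I * l * t)) *
              conj (ζ t)) := by ring
          simp only [e]
          rw [norm_mul, norm_mul, RCLike.norm_conj, norm_mul, norm_mul, norm_mul, RCLike.norm_conj,
            hn, norm_neg, Complex.norm_I]
          have := hζn t
          calc 1 * ‖osc v l t‖ * (1 * (‖pot v t‖ * 1) * ‖ζ t‖) =
              ‖ζ t‖ * (‖pot v t‖ * ‖osc v l t‖) := by ring
            _ ≤ _ := by gcongr
      _ ≤ _ := by
          rw [integral_const_mul]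
          gcongr
          exact integral_norm_pot_mul_le v (osc v l).memLp
  have h3 := h1.trans h2
  calc ‖ζ x - 1‖ = ‖(ζ x + Complex.I * (osc v l x * conj (ζ x)) - 1) -
        Complex.I * (osc v l x * conj (ζ x))‖ := by congr 1; ring
    _ ≤ Real.exp ‖v‖ * (‖v‖ * oscNorm v l) + ‖osc v l x‖ * ‖ζ x‖ := by
        refine (_root_.norm_sub_le _ _).trans (add_le_add h3 ?_)
        simp
    _ ≤ Real.exp ‖v‖ * (‖v‖ * oscNorm v l) + ‖osc v l x‖ * Real.exp ‖v‖ := by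
        gcongr; exact hζn x
    _ = _ := by ring

/-- In terms of `ζ`, the integrand `v z̄/z` is `v e^{-2iλt} ζ̄/ζ`. Replacing `ζ̄/ζ` by `1` costs at
most `2|ζ - 1|/|ζ|`, and the remaining term integrates to `osc v l 1`. -/
theorem abs_ang_sub_le_osc (v : H) (l : ℝ) :
    |ang (v, l) - l| ≤ ‖osc v l 1‖ +
      2 * Real.exp ‖v‖ ^ 2 * (‖v‖ + ‖v‖ ^ 2) * oscNorm v l := by
  set ζ : ℝ → ℂ := fun x => Complex.exp (-Complex.I * l * x) * sol (v, l) 1 x with hζ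
  rw [ang, add_sub_cancel_left]
  refine (Complex.abs_im_le_norm _).trans ?_
  have hp := ((prim_volterra (v, 0) (phase (v, l))).add ((prim_osc v l).const_mul Complex.I))
  have h1 := hp.norm_sub_le (x := 1) (by simp)
  have hv0 : volterra (v, 0) (phase (v, l)) 0 = 0 := by
    simp [volterra_apply, clamp_of_mem (x := 0) (by simp)]
  simp only [osc_zero, mul_zero, add_zero, hv0, sub_zero] at h1
  have hi : Integrable (fun t => ‖pot v t‖ * ‖osc v l t‖) unitMeasure :=
    (memLp_pot v).norm.integrable_mul (osc v l).memLp.norm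
  have hi2 : Integrable (fun t => 2 * Real.exp ‖v‖ ^ 2 * (‖pot v t‖ * ‖osc v l t‖ +
      ‖pot v t‖ * (‖v‖ * oscNorm v l))) unitMeasure :=
    (hi.add ((integrable_pot v).norm.mul_const _)).const_mul _
  have h2 : ∫ t, ‖rhs v 0 (phase (v, l)) t +
      Complex.I * (pot v t * Complex.exp (-2 * Complex.I * l * t))‖ ∂unitMeasure ≤
      ∫ t, 2 * Real.exp ‖v‖ ^ 2 * (‖pot v t‖ * ‖osc v l t‖ +
      ‖pot v t‖ * (‖v‖ * oscNorm v l)) ∂unitMeasure := by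
    refine integral_mono_ae hp.int.norm hi2 ?_
    refine (ae_restrict_mem measurableSet_Ioo).mono fun t ht => ?_
    have hb := norm_exp_mul_sol_sub_le v l (x := t) ⟨ht.1.le, ht.2.le⟩
    change ‖ζ t - 1‖ ≤ _ at hb
    have hz := sol_one_ne_zero (v, l) t
    have hzc : conj (sol (v, l) 1 t) ≠ 0 := (map_ne_zero _).2 hz
    have hN := oscNorm_nonneg v l
    have he := Complex.exp_ne_zero (-Complex.I * l * t)
    have hζ0 : ζ t ≠ 0 := mul_ne_zero he hz
    have hlow : Real.exp (-‖v‖) ≤ ‖ζ t‖ := by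
      simp only [hζ, norm_mul, norm_exp_mul_I, one_mul]
      exact le_norm_sol (v, l) t
    have hce : conj (Complex.exp (-Complex.I * l * t)) = (Complex.exp (-Complex.I * l * t))⁻¹ := by
      rw [← Complex.exp_conj, ← Complex.exp_neg]; congr 1; simp
    have h2e : Complex.exp (-2 * Complex.I * l * t) = Complex.exp (-Complex.I * l * t) ^ 2 := by
      rw [← Complex.exp_nat_mul]; congr 1; push_cast; ring
    have e : rhs v 0 (phase (v, l)) t +
        Complex.I * (pot v t * Complex.exp (-2 * Complex.I * l * t)) =
        Complex.I * pot v t * Complex.exp (-2 * Complex.I * l * t) *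
          ((ζ t - 1) - conj (ζ t - 1)) * (ζ t)⁻¹ := by
      simp only [rhs, phase_apply, map_mul, Complex.conj_conj, map_sub, map_one, hζ, hce, h2e,
        map_inv₀]
      push_cast
      field_simp
      ring
    simp only
    rw [e]
    have hinv : ‖(ζ t)⁻¹‖ ≤ Real.exp ‖v‖ := by
      rw [norm_inv, ← inv_inv (Real.exp ‖v‖), ← Real.exp_neg]
      gcongr
    have hsub : ‖(ζ t - 1) - conj (ζ t - 1)‖ ≤ 2 * ‖ζ t - 1‖ := by
      refine (_root_.norm_sub_le _ _).trans ?_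
      rw [RCLike.norm_conj]; linarith
    have hn : ‖Complex.exp (-2 * Complex.I * l * t)‖ = 1 := by
      rw [Complex.norm_exp]; simp
    rw [norm_mul, norm_mul, norm_mul, norm_mul, hn, Complex.norm_I]
    calc 1 * ‖pot v t‖ * 1 * ‖(ζ t - 1) - conj (ζ t - 1)‖ * ‖(ζ t)⁻¹‖
        ≤ 1 * ‖pot v t‖ * 1 * (2 * (Real.exp ‖v‖ * (‖osc v l t‖ + ‖v‖ * oscNorm v l))) *
          Real.exp ‖v‖ := by
          gcongr
          exact hsub.trans (by gcongr)
      _ = _ := by ring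
  have h3 : ∫ t, 2 * Real.exp ‖v‖ ^ 2 * (‖pot v t‖ * ‖osc v l t‖ +
      ‖pot v t‖ * (‖v‖ * oscNorm v l)) ∂unitMeasure ≤
      2 * Real.exp ‖v‖ ^ 2 * (‖v‖ + ‖v‖ ^ 2) * oscNorm v l := by
    rw [integral_const_mul, integral_add hi ((integrable_pot v).norm.mul_const _),
      integral_mul_const]
    have a := integral_norm_pot_mul_le v (osc v l).memLp
    have b := integral_norm_pot_le v
    have hN := oscNorm_nonneg v l
    calc _ ≤ 2 * Real.exp ‖v‖ ^ 2 * (‖v‖ * oscNorm v l + ‖v‖ * (‖v‖ * oscNorm v l)) := by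
          gcongr
          exact a
      _ = _ := by ring
  have h4 := h1.trans (h2.trans h3)
  calc ‖volterra (v, 0) (phase (v, l)) 1‖ =
        ‖(volterra (v, 0) (phase (v, l)) 1 + Complex.I * osc v l 1) -
          Complex.I * osc v l 1‖ := by congr 1; ring
    _ ≤ _ := by
      refine (_root_.norm_sub_le _ _).trans ?_
      simp only [norm_mul, Complex.norm_I, one_mul]
      linarith

/-- The size of the perturbation at the spectral parameter `c`. -/
def eps (v : H) (c : ℝ) : ℝ := ‖osc v c 1‖ + oscNorm v c

theorem eps_nonneg (v : H) (c : ℝ) : 0 ≤ eps v c :=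
  add_nonneg (norm_nonneg _) (oscNorm_nonneg _ _)

theorem abs_ev_sub_le (v : H) (c : ℝ) : |ev c v - c| ≤ ‖v‖ := by
  have := abs_ang_sub_le (v, ev c v)
  rw [ang_ev, abs_sub_comm] at this
  exact this

/-- At `λ = ev c v` the angle is `c`, so `abs_ang_sub_le_osc` bounds the shift by oscillatory
integrals at `λ`. The crude bound `|λ - c| ≤ ‖v‖` allows these to be moved to `c`. -/
theorem exists_abs_ev_sub_le (v : H) : ∃ K, 0 ≤ K ∧ ∀ c, |ev c v - c| ≤ K * eps v c := by
  refine ⟨1 + 2 * ‖v‖ + 2 * Real.exp ‖v‖ ^ 2 * (‖v‖ + ‖v‖ ^ 2) * (2 + 3 * ‖v‖), by positivity,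
    fun c => ?_⟩
  have hd := abs_ev_sub_le v c
  have h := abs_ang_sub_le_osc v (ev c v)
  rw [ang_ev, abs_sub_comm] at h
  have e : ev c v = c + (ev c v - c) := by ring
  have h1 := norm_osc_add_le v c (ev c v - c) (x := 1) (by simp)
  have h2 := oscNorm_add_le v (c := c) hd
  rw [← e] at h1 h2
  have hN := oscNorm_nonneg v c
  have hG := norm_nonneg (osc v c 1)
  have h3 : 2 * |ev c v - c| * oscNorm v c ≤ 2 * ‖v‖ * oscNorm v c := by gcongr
  calc |ev c v - c| ≤ _ := h
    _ ≤ (‖osc v c 1‖ + 2 * ‖v‖ * oscNorm v c) + 2 * Real.exp ‖v‖ ^ 2 * (‖v‖ + ‖v‖ ^ 2) *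
        ((2 + 3 * ‖v‖) * oscNorm v c) := by
        gcongr
        linarith
    _ ≤ _ := by
        rw [eps]
        have : 0 ≤ 2 * ‖v‖ + 2 * Real.exp ‖v‖ ^ 2 * (‖v‖ + ‖v‖ ^ 2) * (2 + 3 * ‖v‖) := by positivity
        nlinarith [mul_nonneg this hG]

theorem norm_exp_sub_one_le (r : ℝ) : ‖Complex.exp (Complex.I * r) - 1‖ ≤ |r| := by
  simpa using Real.norm_exp_I_mul_ofReal_sub_one_le (x := r)

/-- The potential `-v` is included at the spectral parameter belonging to `v`, since `y` is `i`
times the solution for `-v`. -/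
theorem exists_norm_sol_sub_le (v : H) : ∃ K, 0 ≤ K ∧ ∀ u : H, (u = v ∨ u = -v) → ∀ c : ℝ,
    ∀ x ∈ Icc (0 : ℝ) 1,
    ‖Complex.exp (-Complex.I * c * x) * sol (u, ev c v) 1 x - 1‖ ≤
      K * (‖osc v c x‖ + eps v c) := by
  obtain ⟨K, hK0, hK⟩ := exists_abs_ev_sub_le v
  refine ⟨Real.exp ‖v‖ * (1 + 2 * ‖v‖ + ‖v‖ * (2 + 3 * ‖v‖)) + K, by positivity,
    fun u hu c x hx => ?_⟩
  have hun : ‖u‖ = ‖v‖ := by rcases hu with rfl | rfl <;> simp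
  have huo : ∀ l y, ‖osc u l y‖ = ‖osc v l y‖ := by
    rcases hu with rfl | rfl <;> simp [norm_osc_neg]
  have huN : ∀ l, oscNorm u l = oscNorm v l := by
    rcases hu with rfl | rfl <;> simp [oscNorm_neg]
  have hd := abs_ev_sub_le v c
  set l := ev c v with hl
  have e : l = c + (l - c) := by ring
  have h1 := norm_osc_add_le v c (l - c) hx
  have h2 := oscNorm_add_le v (c := c) hd
  rw [← e] at h1 h2
  have hN := oscNorm_nonneg v c
  have h3 : 2 * |l - c| * oscNorm v c ≤ 2 * ‖v‖ * oscNorm v c := by gcongr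
  have hNe : oscNorm v c ≤ eps v c := by rw [eps]; linarith [norm_nonneg (osc v c 1)]
  have h4 := norm_exp_mul_sol_sub_le u l hx
  rw [hun, huo, huN] at h4
  have h5 : ‖Complex.exp (-Complex.I * l * x) * sol (u, l) 1 x - 1‖ ≤
      Real.exp ‖v‖ * (1 + 2 * ‖v‖ + ‖v‖ * (2 + 3 * ‖v‖)) * (‖osc v c x‖ + eps v c) := by
    refine h4.trans ?_
    rw [mul_assoc]
    gcongr
    calc ‖osc v l x‖ + ‖v‖ * oscNorm v l
        ≤ (‖osc v c x‖ + 2 * ‖v‖ * oscNorm v c) + ‖v‖ * ((2 + 3 * ‖v‖) * oscNorm v c) := by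
          gcongr
          linarith
      _ ≤ (‖osc v c x‖ + 2 * ‖v‖ * eps v c) + ‖v‖ * ((2 + 3 * ‖v‖) * eps v c) := by gcongr
      _ ≤ _ := by
          have : 0 ≤ 2 * ‖v‖ + ‖v‖ * (2 + 3 * ‖v‖) := by positivity
          nlinarith [mul_nonneg this (norm_nonneg (osc v c x)), eps_nonneg v c]
  have e2 : Complex.exp (-Complex.I * c * x) * sol (u, l) 1 x - 1 =
      Complex.exp (Complex.I * ((l - c) * x : ℝ)) *
        (Complex.exp (-Complex.I * l * x) * sol (u, l) 1 x - 1) +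
      (Complex.exp (Complex.I * ((l - c) * x : ℝ)) - 1) := by
    have : Complex.exp (-Complex.I * c * x) = Complex.exp (Complex.I * ((l - c) * x : ℝ)) *
        Complex.exp (-Complex.I * l * x) := by
      rw [← Complex.exp_add]; congr 1; push_cast; ring
    rw [this]; ring
  have hn : ‖Complex.exp (Complex.I * ((l - c) * x : ℝ))‖ = 1 := by
    rw [Complex.norm_exp]; simp
  rw [e2]
  refine (norm_add_le _ _).trans ?_
  rw [norm_mul, hn, one_mul, add_mul]
  refine add_le_add h5 ((norm_exp_sub_one_le _).trans ?_)
  rw [abs_mul, abs_of_nonneg hx.1]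
  calc |l - c| * x ≤ |l - c| * 1 := by gcongr; exact hx.2
    _ ≤ K * eps v c := by rw [mul_one]; exact hK c
    _ ≤ _ := by gcongr; linarith [norm_nonneg (osc v c x)]

/-! ### Asymptotics of the gradients -/

theorem norm_exp_two_mul (c x : ℝ) : ‖Complex.exp (2 * Complex.I * c * x)‖ = 1 := by
  rw [Complex.norm_exp]; simp

/-- The function `e^{2icx}`. -/
def free (c : ℝ) : X :=
  BoundedContinuousFunction.ofNormedAddCommGroup (fun x => Complex.exp (2 * Complex.I * c * x))
    (by fun_prop) 1 (fun x => (norm_exp_two_mul c x).le)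

theorem free_apply (c x : ℝ) : free c x = Complex.exp (2 * Complex.I * c * x) := rfl

theorem pot_sub (v w : H) : pot (v - w) =ᵐ[unitMeasure] fun t => pot v t - pot w t := by
  filter_upwards [pot_add v (-w), pot_neg w] with t h1 h2
  rw [sub_eq_add_neg, h1, h2, sub_eq_add_neg]

theorem integral_osc_add_eps_le (v : H) (c : ℝ) :
    ∫ t, (‖osc v c t‖ + eps v c) ∂unitMeasure ≤ 2 * eps v c := by
  rw [integral_add (osc v c).integrable.norm (integrable_const _)]
  have h := integral_norm_osc_le v c
  have h2 : oscNorm v c ≤ eps v c := by rw [eps]; linarith [norm_nonneg (osc v c 1)]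
  simp
  linarith

/-- The oscillatory integral is controlled by `eps` at the end point and in mean square, but not at
every point; pointwise bounds must therefore keep `‖osc v c t‖` until they are integrated. -/
theorem norm_le_of_pot_le {v f : H} {c K : ℝ} (hK : 0 ≤ K)
    (h : ∀ᵐ t ∂unitMeasure, ‖pot f t‖ ≤ K * (‖osc v c t‖ + eps v c)) :
    ‖f‖ ≤ 2 * K * eps v c := by
  have he := eps_nonneg v c
  refine (le_abs_self _).trans (abs_le_of_sq_le_sq ?_ (by positivity))
  rw [norm_sq_eq_integral]
  have hi := (osc v c).memLp.norm.integrable_sq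
  calc ∫ t, ‖pot f t‖ ^ 2 ∂unitMeasure ≤
      ∫ t, (2 * K ^ 2 * ‖osc v c t‖ ^ 2 + 2 * K ^ 2 * eps v c ^ 2) ∂unitMeasure := by
        refine integral_mono_ae (memLp_pot f).norm.integrable_sq
          ((hi.const_mul _).add (integrable_const _)) ?_
        filter_upwards [h] with t ht
        have h1 : ‖pot f t‖ ^ 2 ≤ (K * (‖osc v c t‖ + eps v c)) ^ 2 := by gcongr
        nlinarith [sq_nonneg (K * (‖osc v c t‖ - eps v c))]
    _ = 2 * K ^ 2 * oscNorm v c ^ 2 + 2 * K ^ 2 * eps v c ^ 2 := by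
        rw [integral_add (hi.const_mul _) (integrable_const _), integral_const_mul, ← oscNorm_sq]
        simp
    _ ≤ 2 * K ^ 2 * eps v c ^ 2 + 2 * K ^ 2 * eps v c ^ 2 := by
        have h2 : oscNorm v c ≤ eps v c := by rw [eps]; linarith [norm_nonneg (osc v c 1)]
        have := oscNorm_nonneg v c
        gcongr
    _ = _ := by ring

theorem norm_mul_sub_le {a b a₀ b₀ : ℂ} {M d : ℝ} (ha : ‖a‖ ≤ M) (hb₀ : ‖b₀‖ ≤ 1)
    (h1 : ‖a - a₀‖ ≤ d) (h2 : ‖b - b₀‖ ≤ d) : ‖a * b - a₀ * b₀‖ ≤ (M + 1) * d := by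
  have hd : 0 ≤ d := (norm_nonneg _).trans h1
  calc ‖a * b - a₀ * b₀‖ = ‖a * (b - b₀) + (a - a₀) * b₀‖ := by congr 1; ring
    _ ≤ M * d + d * 1 := by
      refine (norm_add_le _ _).trans ?_
      rw [norm_mul, norm_mul]
      gcongr
      exact (norm_nonneg _).trans ha
    _ = _ := by ring

/-- Both gradients differ from those of the free system by `O(eps)`. -/
theorem exists_norm_grad_sub_le (v : H) : ∃ K, 0 ≤ K ∧ ∀ c : ℝ,
    ‖evGrad c v - toH (free c)‖ ≤ K * eps v c ∧
    ‖kapGrad c v - toH (-(Complex.I • free c))‖ ≤ K * eps v c := by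
  obtain ⟨K, hK0, hK⟩ := exists_norm_sol_sub_le v
  set M := Real.exp ‖v‖ with hM
  have hM1 : 1 ≤ M := Real.one_le_exp (norm_nonneg v)
  set L := (M + 1) * K with hL
  have hL0 : 0 ≤ L := by positivity
  suffices hsuff : ∀ c : ℝ,
      ‖evGrad c v - toH (free c)‖ ≤ 2 * (M ^ 2 * (3 * L)) * eps v c ∧
      ‖kapGrad c v - toH (-(Complex.I • free c))‖ ≤ 2 * (2 * L * M ^ 4 + L) * eps v c by
    refine ⟨2 * (M ^ 2 * (3 * L)) + 2 * (2 * L * M ^ 4 + L), by positivity, fun c => ?_⟩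
    have he := eps_nonneg v c
    refine ⟨(hsuff c).1.trans ?_, (hsuff c).2.trans ?_⟩
    · gcongr; exact le_add_of_nonneg_right (by positivity)
    · gcongr; exact le_add_of_nonneg_left (by positivity)
  intro c
  have he := eps_nonneg v c
  set l := ev c v with hl
  set z := sol (v, l) 1 with hz
  set y := sol (v, l) Complex.I with hy
  let Z : ℝ → ℂ := fun x => Complex.exp (-Complex.I * c * x) * z x
  let Y : ℝ → ℂ := fun x => Complex.exp (-Complex.I * c * x) * y x
  have hyx : ∀ x, y x = Complex.I * sol (-v, l) 1 x := fun x => by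
    rw [hy, sol_I_eq]; simp
  have hzn : ∀ x, ‖z x‖ ≤ M := norm_sol_le (v, l)
  have hyn : ∀ x, ‖y x‖ ≤ M := fun x => by
    rw [hyx, norm_mul, Complex.norm_I, one_mul]
    simpa using norm_sol_le (-v, l) x
  have hZn : ∀ x, ‖Z x‖ ≤ M := fun x => by
    simp only [Z, norm_mul, norm_exp_mul_I, one_mul]; exact hzn x
  have hYn : ∀ x, ‖Y x‖ ≤ M := fun x => by
    simp only [Y, norm_mul, norm_exp_mul_I, one_mul]; exact hyn x
  let m : ℝ → ℝ := fun x => ‖osc v c x‖ + eps v c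
  have hZ : ∀ x ∈ Icc (0 : ℝ) 1, ‖Z x - 1‖ ≤ K * m x := fun x hx => hK v (Or.inl rfl) c x hx
  have hY : ∀ x ∈ Icc (0 : ℝ) 1, ‖Y x - Complex.I‖ ≤ K * m x := fun x hx => by
    have := hK (-v) (Or.inr rfl) c x hx
    have e : Y x - Complex.I =
        Complex.I * (Complex.exp (-Complex.I * c * x) * sol (-v, l) 1 x - 1) := by
      simp only [Y, hyx]; ring
    rw [e, norm_mul, Complex.norm_I, one_mul]
    exact this
  have hmi : Integrable m unitMeasure := (osc v c).integrable.norm.add (integrable_const _)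
  have hmint : ∫ t, m t ∂unitMeasure ≤ 2 * eps v c := integral_osc_add_eps_le v c
  have hme : ∀ t, eps v c ≤ m t := fun t => by simp only [m]; linarith [norm_nonneg (osc v c t)]
  have hZZ : ∀ x ∈ Icc (0 : ℝ) 1, ‖Z x * Z x - 1‖ ≤ L * m x := fun x hx => by
    have := norm_mul_sub_le (hZn x) (b₀ := 1) (by simp) (hZ x hx) (hZ x hx)
    have e : L * m x = (M + 1) * (K * m x) := by rw [hL]; ring
    rw [e]; simpa using this
  have hZY : ∀ x ∈ Icc (0 : ℝ) 1, ‖Z x * Y x - Complex.I‖ ≤ L * m x := fun x hx => by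
    have := norm_mul_sub_le (hZn x) (b₀ := Complex.I) (by simp) (hZ x hx) (hY x hx)
    have e : L * m x = (M + 1) * (K * m x) := by rw [hL]; ring
    rw [e]; simpa using this
  have hYZ : ∀ x ∈ Icc (0 : ℝ) 1, ‖conj (Y x) * Z x + Complex.I‖ ≤ L * m x := fun x hx => by
    have h1 : ‖conj (Y x) - conj Complex.I‖ ≤ K * m x := by
      rw [← map_sub, RCLike.norm_conj]; exact hY x hx
    have := norm_mul_sub_le (a := conj (Y x)) (M := M) (by rw [RCLike.norm_conj]; exact hYn x)
      (b₀ := 1) (by simp) h1 (hZ x hx)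
    have e : L * m x = (M + 1) * (K * m x) := by rw [hL]; ring
    rw [e]; simpa using this
  -- The free factor `e^{2icx}` undoes the two rotations, so products of solutions become `free c`
  -- times products of `Z` and `Y`.
  have hE : ∀ x : ℝ, free c x * Complex.exp (-Complex.I * c * x) * Complex.exp (-Complex.I * c * x)
      = 1 := fun x => by
    rw [free_apply, ← Complex.exp_add, ← Complex.exp_add]
    have : 2 * Complex.I * c * x + -Complex.I * c * x + -Complex.I * c * x = 0 := by ring
    rw [this, Complex.exp_zero]
  have hfn : ∀ x, ‖free c x‖ = 1 := norm_exp_two_mul c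
  have hzz : ∀ x, z x * z x = free c x * (Z x * Z x) := fun x => by
    simp only [Z]
    linear_combination (-(z x * z x)) * hE x
  have hzy : ∀ x, z x * y x = free c x * (Z x * Y x) := fun x => by
    simp only [Z, Y]
    linear_combination (-(z x * y x)) * hE x
  have hN0 := nsq_pos (v, l)
  have hN1 : |nsq (v, l) - 1| ≤ L * (2 * eps v c) := by
    have e1 : nsq (v, l) - 1 = ∫ t, (‖z t‖ ^ 2 - 1) ∂unitMeasure := by
      rw [integral_sub z.memLp.norm.integrable_sq (integrable_const _), nsq]
      simp [hz]
    rw [e1]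
    calc |∫ t, (‖z t‖ ^ 2 - 1) ∂unitMeasure| ≤ ∫ t, L * m t ∂unitMeasure := by
          rw [← Real.norm_eq_abs]
          refine norm_integral_le_of_norm_le (hmi.const_mul L)
            ((ae_restrict_mem measurableSet_Ioo).mono fun t ht => ?_)
          have h1 := hZZ t ⟨ht.1.le, ht.2.le⟩
          have h2 := abs_norm_sub_norm_le (Z t * Z t) 1
          have h3 : ‖Z t‖ = ‖z t‖ := by simp only [Z, norm_mul, norm_exp_mul_I, one_mul]
          rw [norm_mul, h3, norm_one, ← sq] at h2
          exact h2.trans h1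
      _ ≤ _ := by
          rw [integral_const_mul]
          gcongr
  have hNinv : (nsq (v, l))⁻¹ ≤ M ^ 2 := by
    have h1 : Real.exp (-‖v‖) ^ 2 ≤ nsq (v, l) := by
      have h : ∫ _, Real.exp (-‖v‖) ^ 2 ∂unitMeasure ≤ nsq (v, l) := by
        refine integral_mono (integrable_const _) z.memLp.norm.integrable_sq fun t => ?_
        have := le_norm_sol (v, l) t
        simp only
        gcongr
      simpa using h
    have h2 : M ^ 2 = (Real.exp (-‖v‖) ^ 2)⁻¹ := by rw [Real.exp_neg, inv_pow, inv_inv]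
    rw [h2]
    gcongr
  have hcr : |cross (v, l)| ≤ L * (2 * eps v c) := by
    calc |∫ t, (conj (y t) * z t).re ∂unitMeasure| ≤ ∫ t, L * m t ∂unitMeasure := by
          rw [← Real.norm_eq_abs]
          refine norm_integral_le_of_norm_le (hmi.const_mul L)
            ((ae_restrict_mem measurableSet_Ioo).mono fun t ht => ?_)
          have h1 := hYZ t ⟨ht.1.le, ht.2.le⟩
          -- Here `ȳz` is close to `-i`, and adding `i` does not change the real part; hence `cross`
          -- is `O(eps)`.
          have h2 : (conj (y t) * z t).re = (conj (Y t) * Z t + Complex.I).re := by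
            have : conj (Y t) * Z t = conj (y t) * z t := by
              have hc : conj (Complex.exp (-Complex.I * c * t)) * Complex.exp (-Complex.I * c * t)
                  = 1 := by
                rw [← Complex.exp_conj, ← Complex.exp_add]
                have : conj (-Complex.I * c * t) + -Complex.I * c * t = 0 := by simp
                rw [this, Complex.exp_zero]
              simp only [Y, Z, map_mul]
              linear_combination (conj (y t) * z t) * hc
            rw [this]; simp
          rw [h2]
          exact (Complex.abs_re_le_norm _).trans h1
      _ ≤ _ := by
          rw [integral_const_mul]
          gcongr
  have hevpot : ∀ᵐ t ∂unitMeasure, pot (evGrad c v) t = ((nsq (v, l))⁻¹ : ℝ) * (z t * z t) := by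
    filter_upwards [pot_smul (nsq (v, l))⁻¹ (toH (z * z)), pot_toH (z * z)] with t h1 h2
    rw [evGrad, ← hl, h1, h2]; rfl
  constructor
  · refine norm_le_of_pot_le (by positivity) ?_
    filter_upwards [pot_sub (evGrad c v) (toH (free c)), hevpot, pot_toH (free c),
      ae_restrict_mem measurableSet_Ioo] with t h1 h2 h3 ht
    have hx : t ∈ Icc (0 : ℝ) 1 := ⟨ht.1.le, ht.2.le⟩
    rw [h1, h2, h3, hzz]
    have e : (((nsq (v, l))⁻¹ : ℝ) : ℂ) * (free c t * (Z t * Z t)) - free c t =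
        free c t * ((((nsq (v, l))⁻¹ : ℝ) : ℂ) * ((Z t * Z t - 1) - ((nsq (v, l) - 1 : ℝ) : ℂ))) := by
      have : ((nsq (v, l) : ℝ) : ℂ) ≠ 0 := by exact_mod_cast hN0.ne'
      push_cast
      field_simp
      ring
    rw [e, norm_mul, hfn, one_mul, norm_mul, Complex.norm_real, Real.norm_of_nonneg (by positivity)]
    have h5 := hme t
    have h6 : L * (2 * eps v c) ≤ L * (2 * m t) := by gcongr
    have h7 := hZZ t hx
    have h8 : ‖(Z t * Z t - 1) - ((nsq (v, l) - 1 : ℝ) : ℂ)‖ ≤ 3 * L * m t := by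
      refine (_root_.norm_sub_le _ _).trans ?_
      rw [Complex.norm_real, Real.norm_eq_abs]
      linarith
    calc _ ≤ M ^ 2 * (3 * L * m t) := mul_le_mul hNinv h8 (norm_nonneg _) (by positivity)
      _ = _ := by simp only [m]; ring
  · refine norm_le_of_pot_le (by positivity) ?_
    filter_upwards [pot_sub (kapGrad c v) (toH (-(Complex.I • free c))), hevpot,
      pot_toH (-(Complex.I • free c)),
      pot_sub (cross (v, l) • evGrad c v) (toH (z * y)),
      pot_smul (cross (v, l)) (evGrad c v), pot_toH (z * y),
      ae_restrict_mem measurableSet_Ioo] with t h1 h2 h3 h4 h5 h6 ht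
    have hx : t ∈ Icc (0 : ℝ) 1 := ⟨ht.1.le, ht.2.le⟩
    rw [h1, kapGrad, ← hl, ← hz, ← hy, h4, h5, h6, h2, h3]
    have e : (cross (v, l) : ℂ) * (((nsq (v, l))⁻¹ : ℝ) * (z t * z t)) - (z * y) t -
        (-(Complex.I • free c)) t = (cross (v, l) : ℂ) * (((nsq (v, l))⁻¹ : ℝ) * (z t * z t)) -
        free c t * (Z t * Y t - Complex.I) := by
      have : (z * y) t = z t * y t := rfl
      rw [this, hzy]
      simp; ring
    rw [e]
    refine (_root_.norm_sub_le _ _).trans ?_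
    rw [norm_mul, norm_mul, norm_mul, norm_mul, hfn, one_mul, Complex.norm_real, Complex.norm_real,
      Real.norm_eq_abs, Real.norm_of_nonneg (inv_nonneg.2 hN0.le), add_mul]
    refine add_le_add ?_ (hZY t hx)
    calc |cross (v, l)| * ((nsq (v, l))⁻¹ * (‖z t‖ * ‖z t‖))
        ≤ L * (2 * eps v c) * (M ^ 2 * (M * M)) := by
          gcongr
          · exact hzn t
          · exact hzn t
      _ ≤ L * (2 * m t) * (M ^ 2 * (M * M)) := by
          gcongr
          exact hme t
      _ = _ := by simp only [m]; ring

/-! ### Fourier series -/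

/-- The asymptotic eigenvalues `πn - b`. -/
def node (b : ℝ) (n : ℤ) : ℝ := Real.pi * n - b

/-- The shift `b` of the nodes is absorbed into the unimodular factor `e^{2ibt}`, leaving ordinary
Fourier coefficients on `[0,1]`. -/
theorem hasSum_parseval (b : ℝ) {g : ℝ → ℂ} (hg : MemLp g 2 unitMeasure) :
    HasSum (fun n : ℤ => ‖∫ t, g t * Complex.exp (-2 * Complex.I * node b n * t) ∂unitMeasure‖ ^ 2)
      (∫ t, ‖g t‖ ^ 2 ∂unitMeasure) := by
  have hn : ∀ t : ℝ, ‖Complex.exp (2 * Complex.I * b * t)‖ = 1 := norm_exp_two_mul b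
  have hm : MemLp (fun t : ℝ => Complex.exp (2 * Complex.I * b * t) * g t) 2 unitMeasure := by
    refine hg.of_le ?_ (Eventually.of_forall fun t => ?_)
    · exact AEStronglyMeasurable.mul (Continuous.aestronglyMeasurable (by fun_prop)) hg.1
    · rw [norm_mul, hn, one_mul]
  have hm' : MemLp (fun t : ℝ => Complex.exp (2 * Complex.I * b * t) * g t) 2
      (volume.restrict (Ioc 0 1)) := by
    rwa [← restrict_Ioo_eq_restrict_Ioc]
  have h := hasSum_sq_fourierCoeffOn zero_lt_one hm'
  convert h using 1
  · ext n
    rw [fourierCoeffOn_eq_integral, ← intervalIntegral_eq_integral]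
    simp only [sub_zero, div_one, one_smul]
    congr 2
    refine intervalIntegral.integral_congr fun t _ => ?_
    simp only [fourier_coe_apply, smul_eq_mul]
    rw [mul_comm, ← mul_assoc, ← Complex.exp_add]
    congr 2
    simp only [node]
    push_cast
    ring
  · rw [intervalIntegral_eq_integral]
    simp only [sub_zero, inv_one, one_smul]
    refine integral_congr_ae (Eventually.of_forall fun t => ?_)
    simp only
    rw [norm_mul, hn, one_mul]

theorem hasSum_osc (v : H) (b : ℝ) {x : ℝ} (hx : x ∈ Icc (0 : ℝ) 1) :
    HasSum (fun n : ℤ => ‖osc v (node b n) x‖ ^ 2)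
      (∫ t, ‖(Iic x).indicator (pot v) t‖ ^ 2 ∂unitMeasure) := by
  have h := hasSum_parseval b ((memLp_pot v).indicator (measurableSet_Iic (a := x)))
  convert h using 3 with n
  rw [osc, primB_apply, clamp_of_mem hx]
  have e : (fun t => (Iic x).indicator (pot v) t * Complex.exp (-2 * Complex.I * node b n * t)) =
      (Iic x).indicator (fun t => pot v t * Complex.exp (-2 * Complex.I * node b n * t)) := by
    ext t
    by_cases ht : t ∈ Iic x <;> simp [ht]
  have hset : Iic x ∩ Ioc 0 1 = Ioc 0 x := by
    ext t
    simp only [mem_inter_iff, mem_Iic, mem_Ioc]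
    exact ⟨fun h => ⟨h.2.1, h.1⟩, fun h => ⟨h.2, h.1, h.2.trans hx.2⟩⟩
  rw [e, integral_indicator measurableSet_Iic, unitMeasure, restrict_Ioo_eq_restrict_Ioc,
    Measure.restrict_restrict measurableSet_Iic, hset, intervalIntegral.integral_of_le hx.1]

/-- For each fixed `x` the numbers `osc v (node b n) x` are Fourier coefficients of `v` cut off at
`x`, with square sum at most `‖v‖²`. Taking `x = 1` handles the first part of `eps`, integrating
over `x` the second. -/
theorem summable_eps_sq (v : H) (b : ℝ) : Summable (fun n : ℤ => eps v (node b n) ^ 2) := by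
  have hle : ∀ x ∈ Icc (0 : ℝ) 1, ∀ s : Finset ℤ, ∑ n ∈ s, ‖osc v (node b n) x‖ ^ 2 ≤ ‖v‖ ^ 2 := by
    intro x hx s
    have h := hasSum_osc v b hx
    refine (sum_le_hasSum s (fun _ _ => sq_nonneg _) h).trans ?_
    rw [norm_sq_eq_integral]
    refine integral_mono
      ((memLp_pot v).indicator (measurableSet_Iic (a := x))).norm.integrable_sq
      (memLp_pot v).norm.integrable_sq fun t => ?_
    have := norm_indicator_le_norm_self (s := Iic x) (pot v) t
    simp only
    gcongr
  have h1 : Summable (fun n : ℤ => ‖osc v (node b n) 1‖ ^ 2) := (hasSum_osc v b (by simp)).summable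
  have h2 : Summable (fun n : ℤ => oscNorm v (node b n) ^ 2) := by
    refine summable_of_sum_le (fun _ => sq_nonneg _) (c := ‖v‖ ^ 2) fun s => ?_
    simp_rw [oscNorm_sq]
    rw [← integral_finsetSum _ fun n _ => (osc v (node b n)).memLp.norm.integrable_sq]
    calc _ ≤ ∫ _, ‖v‖ ^ 2 ∂unitMeasure := by
          refine integral_mono_ae
            (integrable_finsetSum _ fun n _ => (osc v (node b n)).memLp.norm.integrable_sq)
            (integrable_const _) ((ae_restrict_mem measurableSet_Ioo).mono fun t ht => ?_)
          exact hle t ⟨ht.1.le, ht.2.le⟩ s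
      _ = _ := by simp
  refine ((h1.mul_left 2).add (h2.mul_left 2)).of_nonneg_of_le (fun _ => sq_nonneg _) fun n => ?_
  rw [eps]
  nlinarith [sq_nonneg (‖osc v (node b n) 1‖ - oscNorm v (node b n))]

theorem integral_free (b : ℝ) (n m : ℤ) :
    ∫ t, conj (free (node b n) t) * free (node b m) t ∂unitMeasure = if n = m then 1 else 0 := by
  have e : ∀ t : ℝ, conj (free (node b n) t) * free (node b m) t =
      Complex.exp ((2 * Real.pi * (m - n : ℤ) * Complex.I) * t) := by
    intro t
    rw [free_apply, free_apply, ← Complex.exp_conj, ← Complex.exp_add]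
    congr 1
    simp [node, map_ofNat]
    ring
  simp_rw [e]
  split_ifs with h
  · subst h; simp
  · rw [← intervalIntegral_eq_integral, integral_exp_mul_complex]
    · have : 2 * (Real.pi : ℂ) * (m - n : ℤ) * Complex.I * (1 : ℝ) =
        (m - n : ℤ) * (2 * Real.pi * Complex.I) := by push_cast; ring
      rw [this, Complex.exp_int_mul_two_pi_mul_I]
      simp
    · have : ((m - n : ℤ) : ℂ) ≠ 0 := by exact_mod_cast sub_ne_zero.2 (Ne.symm h)
      simp [Real.pi_ne_zero, Complex.I_ne_zero]
      intro hmn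
      exact this (by push_cast; exact hmn)

/-- The free family: the gradients of the eigenvalues and norming constants at `v = 0`. -/
def freeFamily (b : ℝ) : ℤ ⊕ ℤ → H :=
  Sum.elim (fun n => toH (free (node b n))) (fun n => toH (-(Complex.I • free (node b n))))

theorem inner_toH_toH (w u : X) :
    inner ℝ (toH w) (toH u) = (∫ t, conj (w t) * u t ∂unitMeasure).re := by
  rw [inner_toH]
  have hi : Integrable (fun t => conj (w t) * u t) unitMeasure := by
    exact (star w * u).integrable
  have := integral_re hi
  simp only [RCLike.re_eq_complex_re] at this
  rw [← this]
  refine integral_congr_ae ?_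
  filter_upwards [pot_toH u] with t ht
  rw [ht]

theorem orthonormal_freeFamily (b : ℝ) : Orthonormal ℝ (freeFamily b) := by
  rw [orthonormal_iff_ite]
  rintro (n | n) (m | m)
  · simp only [freeFamily, Sum.elim_inl, inner_toH_toH, integral_free, Sum.inl.injEq]
    split_ifs <;> simp
  · simp only [freeFamily, Sum.elim_inl, Sum.elim_inr, inner_toH_toH, reduceCtorEq, if_false]
    have e : ∀ t : ℝ, conj (free (node b n) t) * (-(Complex.I • free (node b m))) t =
        -Complex.I * (conj (free (node b n) t) * free (node b m) t) := fun t => by simp; ring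
    simp_rw [e]
    rw [integral_const_mul, integral_free]
    split_ifs <;> simp
  · simp only [freeFamily, Sum.elim_inl, Sum.elim_inr, inner_toH_toH, reduceCtorEq, if_false]
    have e : ∀ t : ℝ, conj ((-(Complex.I • free (node b n))) t) * free (node b m) t =
        Complex.I * (conj (free (node b n) t) * free (node b m) t) := fun t => by simp; ring
    simp_rw [e]
    rw [integral_const_mul, integral_free]
    split_ifs <;> simp
  · simp only [freeFamily, Sum.elim_inr, inner_toH_toH, Sum.inr.injEq]
    have e : ∀ t : ℝ, conj ((-(Complex.I • free (node b n))) t) * (-(Complex.I • free (node b m))) t =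
        (conj (free (node b n) t) * free (node b m) t) := fun t => by
      simp
      linear_combination (-(conj (free (node b n) t) * free (node b m) t)) * Complex.I_sq
    simp_rw [e]
    rw [integral_free]
    split_ifs <;> simp

/-- Orthogonality to `e^{2icx}` and to `-i e^{2icx}` kills the real and the imaginary part of each
complex Fourier coefficient; Parseval concludes. -/
theorem span_freeFamily_orthogonal (b : ℝ) :
    (Submodule.span ℝ (Set.range (freeFamily b)))ᗮ = ⊥ := by
  rw [Submodule.eq_bot_iff]
  intro f hf
  have hin : ∀ i, inner ℝ (freeFamily b i) f = 0 := fun i =>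
    (Submodule.mem_orthogonal _ _).1 hf _ (Submodule.subset_span ⟨i, rfl⟩)
  have hz : ∀ n : ℤ, ∫ t, pot f t * Complex.exp (-2 * Complex.I * node b n * t) ∂unitMeasure = 0 := by
    intro n
    have hi := integrable_pot_mul_exp f (node b n)
    have e : ∀ t : ℝ, conj (free (node b n) t) = Complex.exp (-2 * Complex.I * node b n * t) := by
      intro t
      rw [free_apply, ← Complex.exp_conj]
      congr 1; simp [map_ofNat]
    have h1 := hin (Sum.inl n)
    have h2 := hin (Sum.inr n)
    simp only [freeFamily, Sum.elim_inl, Sum.elim_inr, inner_toH] at h1 h2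
    apply Complex.ext
    · have := integral_re hi
      simp only [RCLike.re_eq_complex_re] at this
      rw [← this, Complex.zero_re, ← h1]
      refine integral_congr_ae (Eventually.of_forall fun t => ?_)
      simp only
      rw [e, mul_comm]
    · have := integral_im hi
      simp only [RCLike.im_eq_complex_im] at this
      rw [← this, Complex.zero_im, ← neg_eq_zero, ← integral_neg, ← h2]
      refine integral_congr_ae (Eventually.of_forall fun t => ?_)
      have : conj ((-(Complex.I • free (node b n))) t) * pot f t =
        Complex.I * (pot f t * Complex.exp (-2 * Complex.I * node b n * t)) := by
        rw [← e]; simp; ring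
      simp only
      rw [this, Complex.I_mul_re]
  have hp := (hasSum_parseval b (memLp_pot f)).tsum_eq
  simp only [hz, norm_zero] at hp
  rw [← norm_sq_eq_integral] at hp
  simp at hp
  exact norm_eq_zero.1 (pow_eq_zero_iff (two_ne_zero)|>.1 hp.symm)

/-- The free family is a Hilbert basis. -/
def freeBasis (b : ℝ) : HilbertBasis (ℤ ⊕ ℤ) ℝ H :=
  HilbertBasis.mkOfOrthogonalEqBot (orthonormal_freeFamily b) (span_freeFamily_orthogonal b)

theorem freeBasis_apply (b : ℝ) (i : ℤ ⊕ ℤ) : freeBasis b i = freeFamily b i := by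
  simp [freeBasis]

/-! ### Bases quadratically close to a Hilbert basis -/

section Bari

variable {ι : Type}

theorem lp_summable_sq (a : lp (fun _ : ι => ℝ) 2) : Summable (fun i => ‖a i‖ ^ 2) := by
  have h := (lp.hasSum_norm (p := 2) (by norm_num) a).summable
  simpa using h

theorem lp_norm_sq (a : lp (fun _ : ι => ℝ) 2) : ∑' i, ‖a i‖ ^ 2 = ‖a‖ ^ 2 := by
  have h := (lp.hasSum_norm (p := 2) (by norm_num) a).tsum_eq
  simpa using h

theorem summable_norm_mul {E : Type*} [NormedAddCommGroup E] {u : ι → E} (hu : Summable fun i => ‖u i‖ ^ 2)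
    (a : lp (fun _ : ι => ℝ) 2) : Summable (fun i => ‖a i‖ * ‖u i‖) := by
  refine ((lp_summable_sq a).add hu).of_nonneg_of_le (fun i => by positivity) fun i => ?_
  nlinarith [sq_nonneg (‖a i‖ - ‖u i‖), sq_nonneg (‖a i‖ + ‖u i‖)]

theorem tsum_norm_mul_le {E : Type*} [NormedAddCommGroup E] {u : ι → E} (hu : Summable fun i => ‖u i‖ ^ 2)
    (a : lp (fun _ : ι => ℝ) 2) :
    ∑' i, ‖a i‖ * ‖u i‖ ≤ √(∑' i, ‖u i‖ ^ 2) * ‖a‖ := by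
  refine (summable_norm_mul hu a).tsum_le_of_sum_le fun s => ?_
  refine (le_abs_self _).trans (abs_le_of_sq_le_sq ?_ (by positivity))
  refine (Finset.sum_mul_sq_le_sq_mul_sq s _ _).trans ?_
  rw [mul_pow, Real.sq_sqrt (tsum_nonneg fun _ => sq_nonneg _), mul_comm, ← lp_norm_sq]
  gcongr
  · exact hu.sum_le_tsum s fun _ _ => sq_nonneg _
  · exact (lp_summable_sq a).sum_le_tsum s fun _ _ => sq_nonneg _

variable {E : Type*} [NormedAddCommGroup E] [InnerProductSpace ℝ E] [CompleteSpace E]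

theorem summable_smul {u : ι → E} (hu : Summable fun i => ‖u i‖ ^ 2)
    (a : lp (fun _ : ι => ℝ) 2) : Summable (fun i => a i • u i) :=
  Summable.of_norm_bounded (summable_norm_mul hu a) fun _ => (norm_smul _ _).le

/-- The operator `a ↦ ∑ aᵢ uᵢ` for a square summable family `u`. -/
def synthesis (u : ι → E) (hu : Summable fun i => ‖u i‖ ^ 2) : lp (fun _ : ι => ℝ) 2 →L[ℝ] E :=
  LinearMap.mkContinuous
    { toFun := fun a => ∑' i, a i • u i
      map_add' := fun a b => by
        rw [← (summable_smul hu a).tsum_add (summable_smul hu b)]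
        simp [add_smul]
      map_smul' := fun r a => by
        simp only [lp.coeFn_smul, Pi.smul_apply, smul_eq_mul, mul_smul, RingHom.id_apply]
        rw [(summable_smul hu a).tsum_const_smul] }
    (√(∑' i, ‖u i‖ ^ 2)) (fun a => by
      refine le_trans ?_ (tsum_norm_mul_le hu a)
      refine (norm_tsum_le_tsum_norm ?_).trans (le_of_eq ?_)
      · simpa only [norm_smul] using summable_norm_mul hu a
      · simp only [norm_smul])

theorem synthesis_apply (u : ι → E) (hu : Summable fun i => ‖u i‖ ^ 2)
    (a : lp (fun _ : ι => ℝ) 2) : synthesis u hu a = ∑' i, a i • u i := rfl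

theorem norm_synthesis_le (u : ι → E) (hu : Summable fun i => ‖u i‖ ^ 2) :
    ‖synthesis u hu‖ ≤ √(∑' i, ‖u i‖ ^ 2) :=
  LinearMap.mkContinuous_norm_le _ (Real.sqrt_nonneg _) _

theorem synthesis_single [DecidableEq ι] (u : ι → E) (hu : Summable fun i => ‖u i‖ ^ 2) (i : ι) :
    synthesis u hu (lp.single 2 i (1 : ℝ)) = u i := by
  rw [synthesis_apply, tsum_eq_single i]
  · simp
  · intro j hj
    simp [lp.single_apply, hj]

/-- An injective finite rank perturbation of the identity is surjective. -/
theorem surjective_one_add_of_finiteRank {F : Type*} [AddCommGroup F] [Module ℝ F]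
    (K : F →ₗ[ℝ] F) [FiniteDimensional ℝ (LinearMap.range K)]
    (hinj : Function.Injective fun x => x + K x) : Function.Surjective fun x => x + K x := by
  let N : LinearMap.range K →ₗ[ℝ] LinearMap.range K :=
    LinearMap.id + K.rangeRestrict.comp (LinearMap.range K).subtype
  have hN : Function.Injective N := by
    intro x y hxy
    have := congrArg Subtype.val hxy
    exact Subtype.ext (hinj this)
  intro y
  obtain ⟨r, hr⟩ := (LinearMap.injective_iff_surjective.1 hN) ⟨K y, y, rfl⟩
  have hr' : (r : F) + K r = K y := congrArg Subtype.val hr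
  -- With `r + K r = K y` solved inside the finite-dimensional range of `K`, the vector `y - r` is a
  -- preimage of `y`.
  refine ⟨y - r, ?_⟩
  simp only [map_sub]
  rw [← hr']; abel

/-- A form of Bari's theorem. The functionals `φ` recover the coefficients, so the synthesis
operator is injective. It equals `Q(1 + K₁ + K₂)` with `Q` unitary, `K₁` of norm below `1` and `K₂`
of finite rank, so injectivity forces surjectivity. -/
theorem exists_equiv_of_quadratically_close [DecidableEq ι] (b : HilbertBasis ι ℝ E) (e : ι → E)
    (hs : Summable fun i => ‖e i - b i‖ ^ 2) (φ : ι → E →L[ℝ] ℝ)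
    (hφ : ∀ i j, φ i (e j) = if i = j then 1 else 0) :
    ∃ T : lp (fun _ : ι => ℝ) 2 ≃L[ℝ] E, ∀ i, T (lp.single 2 i (1 : ℝ)) = e i := by
  classical
  let Q : lp (fun _ : ι => ℝ) 2 →L[ℝ] E := (b.repr.symm.toContinuousLinearEquiv : _ →L[ℝ] E)
  let R : E →L[ℝ] lp (fun _ : ι => ℝ) 2 := (b.repr.toContinuousLinearEquiv : E →L[ℝ] _)
  have hQR : ∀ x, Q (R x) = x := fun x => b.repr.symm_apply_apply x
  let u : ι → E := fun i => e i - b i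
  let T : lp (fun _ : ι => ℝ) 2 →L[ℝ] E := Q + synthesis u hs
  have hT : ∀ i, T (lp.single 2 i (1 : ℝ)) = e i := by
    intro i
    have h1 : Q (lp.single 2 i (1 : ℝ)) = b i := b.repr_symm_single i
    change Q _ + synthesis u hs _ = _
    rw [h1, synthesis_single]
    simp [u]
  have hφT : ∀ i a, φ i (T a) = a i := by
    intro i a
    have h1 := ((φ i).comp T).hasSum (lp.hasSum_single (p := 2) (by norm_num) a)
    have h2 : (fun j => (φ i).comp T (lp.single 2 j (a j))) = fun j => if j = i then a i else 0 := by
      ext j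
      have : lp.single 2 j (a j) = (a j) • lp.single (E := fun _ : ι => ℝ) 2 j (1 : ℝ) := by
        rw [← lp.single_smul]; simp
      rw [this, map_smul, ContinuousLinearMap.comp_apply, hT, hφ]
      by_cases h : j = i
      · subst h; simp
      · simp [h, Ne.symm h]
    rw [h2] at h1
    exact h1.unique (hasSum_ite_eq i (a i))
  have hTinj : Function.Injective T := fun a a' h => by
    ext i
    rw [← hφT, ← hφT, h]
  -- A tail of square sum below `1/4` gives `K₁` norm at most `1/2`.
  obtain ⟨s, hsmall⟩ : ∃ s : Finset ι, ∑' i, ‖u i‖ ^ 2 - ∑ i ∈ s, ‖u i‖ ^ 2 < 1 / 4 := by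
    have := (hs.hasSum.eventually (lt_mem_nhds (show ∑' i, ‖u i‖ ^ 2 - 1 / 4 < ∑' i, ‖u i‖ ^ 2 by
      linarith))).exists
    obtain ⟨s, hs'⟩ := this
    exact ⟨s, by simp only [u] at hs' ⊢; linarith⟩
  let u₁ : ι → E := fun i => if i ∈ s then 0 else u i
  let u₂ : ι → E := fun i => if i ∈ s then u i else 0
  have hu₁ : Summable fun i => ‖u₁ i‖ ^ 2 := hs.of_nonneg_of_le (fun _ => sq_nonneg _) fun i => by
    by_cases h : i ∈ s
    · simp [u₁, h]
    · simp [u₁, u, h]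
  have hu₂ : Summable fun i => ‖u₂ i‖ ^ 2 := hs.of_nonneg_of_le (fun _ => sq_nonneg _) fun i => by
    by_cases h : i ∈ s
    · simp [u₂, u, h]
    · simp [u₂, h]
  have hsum : synthesis u hs = synthesis u₁ hu₁ + synthesis u₂ hu₂ := by
    ext a
    change ∑' i, a i • u i = ∑' i, a i • u₁ i + ∑' i, a i • u₂ i
    rw [← (summable_smul hu₁ a).tsum_add (summable_smul hu₂ a)]
    congr 1; ext i
    by_cases h : i ∈ s <;> simp [u₁, u₂, h]
  have hnorm : ‖R.comp (synthesis u₁ hu₁)‖ < 1 := by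
    have h1 : ∑' i, ‖u₁ i‖ ^ 2 < 1 / 4 := by
      have h2 : ∑' i, ‖u₂ i‖ ^ 2 = ∑ i ∈ s, ‖u i‖ ^ 2 := by
        rw [tsum_eq_sum (s := s) fun i hi => by simp [u₂, hi]]
        exact Finset.sum_congr rfl fun i hi => by simp [u₂, hi]
      have h3 : ∑' i, ‖u i‖ ^ 2 = ∑' i, ‖u₁ i‖ ^ 2 + ∑' i, ‖u₂ i‖ ^ 2 := by
        rw [← hu₁.tsum_add hu₂]
        congr 1; ext i
        by_cases h : i ∈ s <;> simp [u₁, u₂, h]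
      linarith
    have h4 : √(∑' i, ‖u₁ i‖ ^ 2) ≤ 1 / 2 := by
      rw [Real.sqrt_le_left (by norm_num)]
      linarith
    refine lt_of_le_of_lt (ContinuousLinearMap.opNorm_le_bound _ (M := 1 / 2) (by norm_num)
      fun a => ?_) (by norm_num)
    have h5 : ‖R (synthesis u₁ hu₁ a)‖ = ‖synthesis u₁ hu₁ a‖ := b.repr.norm_map _
    rw [ContinuousLinearMap.comp_apply, h5]
    exact ((synthesis u₁ hu₁).le_opNorm a).trans
      (by gcongr; exact (norm_synthesis_le u₁ hu₁).trans h4)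
  let K₁ : lp (fun _ : ι => ℝ) 2 →L[ℝ] lp (fun _ : ι => ℝ) 2 := R.comp (synthesis u₁ hu₁)
  let K₂ : lp (fun _ : ι => ℝ) 2 →L[ℝ] lp (fun _ : ι => ℝ) 2 := R.comp (synthesis u₂ hu₂)
  have hunit : IsUnit (1 + K₁) := by
    have := isUnit_one_sub_of_norm_lt_one (R := lp (fun _ : ι => ℝ) 2 →L[ℝ] lp (fun _ : ι => ℝ) 2)
      (x := -K₁) (by rw [norm_neg]; exact hnorm)
    rwa [sub_neg_eq_add] at this
  obtain ⟨U, hU⟩ := hunit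
  let V := ((U⁻¹ : (lp (fun _ : ι => ℝ) 2 →L[ℝ] lp (fun _ : ι => ℝ) 2)ˣ) :
    lp (fun _ : ι => ℝ) 2 →L[ℝ] lp (fun _ : ι => ℝ) 2)
  have hUV : ∀ a, (1 + K₁) (V a) = a := fun a => by
    rw [← hU, ← mul_apply_eq_comp, Units.mul_inv, one_apply_eq_self]
  -- With `V` the inverse of `1 + K₁`, the operator `1 + K₁ + K₂` factors as `(1 + K₁)(1 + V K₂)`.
  have hTdec : ∀ a, T a = Q ((1 + K₁) (a + V (K₂ a))) := by
    intro a
    have h1 : T a = Q a + (synthesis u₁ hu₁ a + synthesis u₂ hu₂ a) := by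
      change Q a + synthesis u hs a = _
      rw [hsum]; rfl
    have h2 : (1 + K₁) a = a + K₁ a := rfl
    rw [map_add (1 + K₁), hUV, h2, map_add, map_add, h1]
    change _ = Q a + Q (R (synthesis u₁ hu₁ a)) + Q (R (synthesis u₂ hu₂ a))
    rw [hQR, hQR, add_assoc]
  have hfin : FiniteDimensional ℝ (LinearMap.range ((V.comp K₂ : _ →L[ℝ] _) :
      lp (fun _ : ι => ℝ) 2 →ₗ[ℝ] lp (fun _ : ι => ℝ) 2)) := by
    have hle : LinearMap.range ((V.comp K₂ : _ →L[ℝ] _) :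
        lp (fun _ : ι => ℝ) 2 →ₗ[ℝ] lp (fun _ : ι => ℝ) 2) ≤
        Submodule.span ℝ ((s.image fun i => V (R (u i)) : Finset _) : Set _) := by
      rintro _ ⟨a, rfl⟩
      have h1 : synthesis u₂ hu₂ a = ∑ i ∈ s, a i • u i := by
        rw [synthesis_apply, tsum_eq_sum (s := s) fun i hi => by simp [u₂, hi]]
        exact Finset.sum_congr rfl fun i hi => by simp [u₂, hi]
      change V (R (synthesis u₂ hu₂ a)) ∈ _
      rw [h1, map_sum, map_sum]
      refine Submodule.sum_mem _ fun i hi => ?_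
      rw [map_smul, map_smul]
      exact Submodule.smul_mem _ _ (Submodule.subset_span (by
        simp only [Finset.coe_image]
        exact ⟨i, hi, rfl⟩))
    exact Submodule.finiteDimensional_of_le hle
  have hsurj := surjective_one_add_of_finiteRank ((V.comp K₂ : _ →L[ℝ] _) :
      lp (fun _ : ι => ℝ) 2 →ₗ[ℝ] lp (fun _ : ι => ℝ) 2) (fun x y h => hTinj (by
        rw [hTdec, hTdec]
        exact congrArg (fun w => Q ((1 + K₁) w)) h))
  have hTsurj : Function.Surjective T := by
    intro y
    obtain ⟨a, ha⟩ := hsurj (V (R y))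
    refine ⟨a, ?_⟩
    have ha' : a + V (K₂ a) = V (R y) := ha
    rw [hTdec, ha', hUV, hQR]
  refine ⟨ContinuousLinearEquiv.ofBijective T (LinearMap.ker_eq_bot.2 hTinj)
    (LinearMap.range_eq_top.2 hTsurj), hT⟩

end Bari

/-! ### Labelling of the eigenvalues -/

theorem strictMono_int_eq_add {σ : ℤ ≃o ℤ} (n : ℤ) : σ n = n + σ 0 := by
  have hs : ∀ m : ℤ, σ (m + 1) = σ m + 1 := fun m => σ.map_succ m
  induction n using Int.induction_on with
  | zero => simp
  | succ k ih => rw [hs, ih]; ring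
  | pred k ih =>
    have := hs (-(k : ℤ) - 1)
    rw [sub_add_cancel, ih] at this
    linarith

/-- Two increasing enumerations of one set differ by an order automorphism of `ℤ`, which is a shift
by some `k`. The common asymptotics force `πk = 0`. -/
theorem IsLabelling.unique {S : Set ℂ} {b : ℝ} {s s' : ℤ → ℝ} (h : IsLabelling S (node b) s)
    (h' : IsLabelling S (node b) s') : s = s' := by
  obtain ⟨hm, hr, ht⟩ := h
  obtain ⟨hm', hr', ht'⟩ := h'
  have hrange : range s = range s' := by
    have e : ∀ q : ℤ → ℝ, range (fun n => (q n : ℂ)) = Complex.ofReal '' range q := fun q => by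
      rw [← range_comp]; rfl
    rw [e] at hr hr'
    exact Complex.ofReal_injective.image_injective (hr.trans hr'.symm)
  let σ : ℤ ≃o ℤ := (hm'.orderIso s').trans ((OrderIso.setCongr _ _ hrange.symm).trans
    (hm.orderIso s).symm)
  have hσ : ∀ n, s (σ n) = s' n := by
    intro n
    have h1 : hm.orderIso s (σ n) = OrderIso.setCongr _ _ hrange.symm (hm'.orderIso s' n) :=
      (hm.orderIso s).apply_symm_apply _
    exact congrArg Subtype.val h1
  have hshift : ∀ n, s' n = s (n + σ 0) := fun n => by
    rw [← hσ, strictMono_int_eq_add]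
  have hinj : Function.Injective (fun n : ℤ => n + σ 0) := add_left_injective _
  have ht2 := ht.comp hinj.tendsto_cofinite
  have ht3 := ht'.sub ht2
  have e : (fun n => s' n - node b n - ((fun n => s n - node b n) ∘ fun n => n + σ 0) n) =
      fun _ => Real.pi * σ 0 := by
    ext n
    simp only [Function.comp, hshift, node]
    push_cast; ring
  rw [e, sub_zero, tendsto_const_nhds_iff] at ht3
  have hσ0 : σ 0 = 0 := by
    have := (mul_eq_zero.1 ht3).resolve_left Real.pi_ne_zero
    exact_mod_cast this
  ext n
  rw [hshift, hσ0, add_zero]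

theorem strictMono_node (b : ℝ) : StrictMono (node b) := fun n m h => by
  have : (n : ℝ) < m := by exact_mod_cast h
  simp only [node]
  have := mul_lt_mul_of_pos_left this Real.pi_pos
  linarith

theorem sin_node_sub (b : ℝ) (n m : ℤ) : Real.sin (node b m - node b n) = 0 := by
  have : node b m - node b n = ((m - n : ℤ) : ℝ) * Real.pi := by
    simp only [node]; push_cast; ring
  rw [this, Real.sin_int_mul_pi]

theorem strictMono_ev (v : H) : StrictMono (fun c => ev c v) := fun c c' h => by
  have := (strictMono_ang v).lt_iff_lt (a := ev c v) (b := ev c' v)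
  simp only [ang_ev] at this
  exact this.1 h

theorem tendsto_eps (v : H) (b : ℝ) : Tendsto (fun n : ℤ => eps v (node b n)) cofinite (𝓝 0) := by
  have h := (summable_eps_sq v b).tendsto_cofinite_zero
  have h2 := (Real.continuous_sqrt.tendsto 0).comp h
  simpa [Function.comp_def, Real.sqrt_sq (eps_nonneg _ _)] using h2

theorem isLabelling_ev (v : H) (b : ℝ) : IsLabelling
    {l | ∃ r : ℝ, (r : ℂ) = l ∧ ∃ n : ℤ, ang (v, r) = node b n} (node b)
    (fun n => ev (node b n) v) := by
  refine ⟨(strictMono_ev v).comp (strictMono_node b), ?_, ?_⟩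
  · ext l
    constructor
    · rintro ⟨n, rfl⟩
      exact ⟨_, rfl, n, ang_ev _ _⟩
    · rintro ⟨r, rfl, n, hn⟩
      exact ⟨n, by simp only [eq_ev hn]⟩
  · obtain ⟨K, -, hK⟩ := exists_abs_ev_sub_le v
    refine squeeze_zero_norm (fun n => hK (node b n)) ?_
    simpa using (tendsto_eps v b).const_mul K

/-! ### Eigenvalues and norming constants in terms of the angle. -/

theorem sol_one_re (p : H × ℝ) : (sol p 1 1).re = ‖sol p 1 1‖ * Real.cos (ang p) := by
  conv_lhs => rw [sol_one_eq, Complex.re_ofReal_mul, Complex.exp_ofReal_mul_I_re]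

theorem sol_one_im (p : H × ℝ) : (sol p 1 1).im = ‖sol p 1 1‖ * Real.sin (ang p) := by
  conv_lhs => rw [sol_one_eq, Complex.im_ofReal_mul, Complex.exp_ofReal_mul_I_im]

theorem eigenvalues_one_one (v : H) : eigenvalues v 1 1 =
    {l | ∃ r : ℝ, (r : ℂ) = l ∧ ∃ n : ℤ, ang (v, r) = node 0 n} := by
  rw [eigenvalues_one_eq]
  ext l
  refine exists_congr fun r => and_congr_right fun _ => ?_
  have hz : ‖sol (v, r) 1 1‖ ≠ 0 := norm_ne_zero_iff.2 (sol_one_ne_zero _ _)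
  simp only [Matrix.cons_val_one, Matrix.cons_val_zero, sol_one_im, mul_eq_zero, hz, false_or,
    Real.sin_eq_zero_iff, node, sub_zero]
  exact exists_congr fun n => by rw [eq_comm, mul_comm]

theorem eigenvalues_one_zero (v : H) : eigenvalues v 1 0 =
    {l | ∃ r : ℝ, (r : ℂ) = l ∧ ∃ n : ℤ, ang (v, r) = node (Real.pi / 2) n} := by
  rw [eigenvalues_one_eq]
  ext l
  refine exists_congr fun r => and_congr_right fun _ => ?_
  have hz : ‖sol (v, r) 1 1‖ ≠ 0 := norm_ne_zero_iff.2 (sol_one_ne_zero _ _)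
  simp only [Matrix.cons_val_zero, sol_one_re, mul_eq_zero, hz, false_or, Real.cos_eq_zero_iff,
    node]
  constructor
  · rintro ⟨k, hk⟩
    -- The zero `(2k + 1)π/2` of the cosine is `π(k + 1) - π/2`, hence the node of index `k + 1`.
    exact ⟨k + 1, by rw [hk]; push_cast; ring⟩
  · rintro ⟨n, hn⟩
    exact ⟨n - 1, by rw [hn]; push_cast; ring⟩

theorem node_zero_eq : (fun m : ℤ => Real.pi * (m : ℝ)) = node 0 := by
  ext m; simp [node]

theorem node_half_eq : (fun m : ℤ => Real.pi * ((m : ℝ) - 1 / 2)) = node (Real.pi / 2) := by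
  ext m; simp only [node]; ring

theorem isLabelling_nu (v : H) : IsLabelling (eigenvalues v 1 1) (node 0) (fun n => nu n v) := by
  have h : ∃ s, IsLabelling (eigenvalues v 1 1) (fun m => Real.pi * m) s :=
    ⟨_, by rw [node_zero_eq, eigenvalues_one_one]; exact isLabelling_ev v 0⟩
  rw [← node_zero_eq]
  exact Classical.epsilon_spec h

theorem isLabelling_rho (v : H) :
    IsLabelling (eigenvalues v 1 0) (node (Real.pi / 2)) (fun n => rho n v) := by
  have h : ∃ s, IsLabelling (eigenvalues v 1 0) (fun m => Real.pi * (m - 1 / 2)) s :=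
    ⟨_, by rw [node_half_eq, eigenvalues_one_zero]; exact isLabelling_ev v (Real.pi / 2)⟩
  rw [← node_half_eq]
  exact Classical.epsilon_spec h

theorem nu_eq (n : ℤ) : nu n = ev (node 0 n) := by
  ext v
  have h := isLabelling_nu v
  rw [eigenvalues_one_one] at h
  exact congrFun (h.unique (isLabelling_ev v 0)) n

theorem rho_eq (n : ℤ) : rho n = ev (node (Real.pi / 2) n) := by
  ext v
  have h := isLabelling_rho v
  rw [eigenvalues_one_zero] at h
  exact congrFun (h.unique (isLabelling_ev v (Real.pi / 2))) n

theorem tau_eq (n : ℤ) : tau n = fun v => rho n (-v) := by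
  ext v
  simp only [tau, rho, eigenvalues_neg]

/-- At `ν_n` the component `ϑ₂(1)` vanishes, so `|ϑ₁(1)|` is the full modulus `|z(1)|`. -/
theorem normS_eq (n : ℤ) : normS n = kap (node 0 n) := by
  ext v
  rw [normS, kap, nu_eq, theta_one]
  have h : (sol (v, ev (node 0 n) v) 1 1).im = 0 := by
    rw [sol_one_im, ang_ev, node, sub_zero, mul_comm Real.pi, Real.sin_int_mul_pi, mul_zero]
  simp only [Matrix.cons_val_zero]
  conv_rhs => rw [← Complex.re_add_im (sol (v, ev (node 0 n) v) 1 1), h]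
  simp

theorem normU_eq (n : ℤ) : normU n = kap (node (Real.pi / 2) n) := by
  ext v
  rw [normU, kap, rho_eq, theta_one]
  have h : (sol (v, ev (node (Real.pi / 2) n) v) 1 1).re = 0 := by
    rw [sol_one_re, ang_ev, node, mul_comm Real.pi, Real.cos_sub_pi_div_two, Real.sin_int_mul_pi,
      mul_zero]
  simp only [Matrix.cons_val_one, Matrix.cons_val_zero]
  conv_rhs => rw [← Complex.re_add_im (sol (v, ev (node (Real.pi / 2) n) v) 1 1), h]
  simp

theorem normT_eq (n : ℤ) : normT n = fun v => normU n (-v) := by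
  ext v
  rw [normT, normU, tau_eq, phi_one_zero, norm_neg]

/-! ### The basis property -/

/-- The canonical relations supply the biorthogonal functionals: the wedge with the gradient of the
norming constant reads off an eigenvalue coefficient, and minus the wedge with the gradient of the
eigenvalue reads off a norming coefficient. -/
theorem isBasis_grad (b : ℝ) (v : H) :
    IsBasis (Sum.elim (fun n : ℤ => evGrad (node b n) v) (fun n : ℤ => kapGrad (node b n) v)) := by
  obtain ⟨K, hK0, hK⟩ := exists_norm_grad_sub_le v
  have hle : ∀ {x e : ℝ}, 0 ≤ x → x ≤ K * e → x ^ 2 ≤ K ^ 2 * e ^ 2 := fun h0 h => by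
    rw [← mul_pow]; gcongr
  have hinj : ∀ n m : ℤ, (node b n = node b m) = (n = m) := fun n m =>
    propext (strictMono_node b).injective.eq_iff
  refine exists_equiv_of_quadratically_close (freeBasis b) _ ?_
    (Sum.elim (fun n => innerSL ℝ (rotH (kapGrad (node b n) v)))
      (fun n => -innerSL ℝ (rotH (evGrad (node b n) v)))) ?_
  · have hs := (summable_eps_sq v b).mul_left (K ^ 2)
    refine Summable.sum _ ?_ ?_
    · refine hs.of_nonneg_of_le (fun _ => sq_nonneg _) fun n => ?_
      simp only [freeBasis_apply, freeFamily]
      exact hle (norm_nonneg _) (hK _).1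
    · refine hs.of_nonneg_of_le (fun _ => sq_nonneg _) fun n => ?_
      simp only [freeBasis_apply, freeFamily]
      exact hle (norm_nonneg _) (hK _).2
  · rintro (n | n) (m | m)
    · simp only [Sum.elim_inl, innerSL_apply_apply, ← wedge_eq_inner,
        wedge_kapGrad_evGrad (sin_node_sub b n m), hinj, Sum.inl.injEq]
    · simp only [Sum.elim_inl, Sum.elim_inr, innerSL_apply_apply, ← wedge_eq_inner,
        wedge_kapGrad_kapGrad (sin_node_sub b n m), reduceCtorEq, if_false]
    · simp only [Sum.elim_inl, Sum.elim_inr, neg_apply, innerSL_apply_apply, ← wedge_eq_inner,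
        wedge_evGrad_evGrad (sin_node_sub b n m), reduceCtorEq, if_false, neg_zero]
    · simp only [Sum.elim_inr, neg_apply, innerSL_apply_apply, ← wedge_eq_inner, Sum.inr.injEq]
      rw [← wedge_antisymm, wedge_kapGrad_evGrad (sin_node_sub b m n)]
      exact if_congr ((Eq.to_iff (hinj m n)).trans eq_comm) rfl rfl

theorem IsBasis.neg {ι : Type} [DecidableEq ι] {e : ι → H} (h : IsBasis e) :
    IsBasis (fun i => -e i) := by
  obtain ⟨T, hT⟩ := h
  exact ⟨T.trans (ContinuousLinearEquiv.neg ℝ), fun i => by simp [hT]⟩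

theorem hasGradientAt_comp_neg {f : H → ℝ} {g v : H} (h : HasGradientAt f g (-v)) :
    HasGradientAt (fun w => f (-w)) (-g) v := by
  rw [hasGradientAt_iff_hasFDerivAt] at h ⊢
  have h' := h.comp v (hasFDerivAt_id (𝕜 := ℝ) v).neg
  refine h'.congr_fderiv ?_
  ext δ
  simp

theorem wedge_neg_neg (f g : H) : wedge (-f) (-g) = wedge f g := by
  rw [← neg_one_smul ℝ f, ← neg_one_smul ℝ g, wedge_smul_left, wedge_smul_right]
  ring

theorem wedge_relations (b : ℝ) (v : H) (n j : ℤ) :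
    wedge (evGrad (node b n) v) (evGrad (node b j) v) = 0 ∧
    wedge (kapGrad (node b n) v) (evGrad (node b j) v) = (if n = j then 1 else 0) ∧
    wedge (kapGrad (node b n) v) (kapGrad (node b j) v) = 0 := by
  refine ⟨wedge_evGrad_evGrad (sin_node_sub b n j) v, ?_,
    wedge_kapGrad_kapGrad (sin_node_sub b n j) v⟩
  rw [wedge_kapGrad_evGrad (sin_node_sub b n j)]
  simp only [(strictMono_node b).injective.eq_iff]

theorem isLabelling_tau (v : H) :
    IsLabelling (eigenvalues v 0 1) (node (Real.pi / 2)) (fun n => tau n v) := by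
  simp only [tau_eq, eigenvalues_neg]
  exact isLabelling_rho (-v)

end ZS

end

theorem theorem4p8 (v : ZS.H) :
    -- the eigenvalues exist, with their labelling
    (ZS.IsLabelling (ZS.eigenvalues v 1 1) (fun m => Real.pi * m) (fun n => ZS.nu n v) ∧
      ZS.IsLabelling (ZS.eigenvalues v 0 1) (fun m => Real.pi * (m - 1 / 2))
        (fun n => ZS.tau n v) ∧
      ZS.IsLabelling (ZS.eigenvalues v 1 0) (fun m => Real.pi * (m - 1 / 2))
        (fun n => ZS.rho n v)) ∧
    -- the gradients exist
    (∀ n : ℤ,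
      DifferentiableAt ℝ (ZS.nu n) v ∧ DifferentiableAt ℝ (ZS.normS n) v ∧
      DifferentiableAt ℝ (ZS.tau n) v ∧ DifferentiableAt ℝ (ZS.normT n) v ∧
      DifferentiableAt ℝ (ZS.rho n) v ∧ DifferentiableAt ℝ (ZS.normU n) v) ∧
    -- the canonical relations
    (∀ n j : ℤ,
      (ZS.wedge (gradient (ZS.nu n) v) (gradient (ZS.nu j) v) = 0 ∧
        ZS.wedge (gradient (ZS.normS n) v) (gradient (ZS.nu j) v) = (if n = j then 1 else 0) ∧
        ZS.wedge (gradient (ZS.normS n) v) (gradient (ZS.normS j) v) = 0) ∧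
      (ZS.wedge (gradient (ZS.tau n) v) (gradient (ZS.tau j) v) = 0 ∧
        ZS.wedge (gradient (ZS.normT n) v) (gradient (ZS.tau j) v) = (if n = j then 1 else 0) ∧
        ZS.wedge (gradient (ZS.normT n) v) (gradient (ZS.normT j) v) = 0) ∧
      (ZS.wedge (gradient (ZS.rho n) v) (gradient (ZS.rho j) v) = 0 ∧
        ZS.wedge (gradient (ZS.normU n) v) (gradient (ZS.rho j) v) = (if n = j then 1 else 0) ∧
        ZS.wedge (gradient (ZS.normU n) v) (gradient (ZS.normU j) v) = 0)) ∧
    -- the bases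
    ZS.IsBasis (Sum.elim (fun n : ℤ => gradient (ZS.nu n) v)
      (fun n : ℤ => gradient (ZS.normS n) v)) ∧
    ZS.IsBasis (Sum.elim (fun n : ℤ => gradient (ZS.tau n) v)
      (fun n : ℤ => gradient (ZS.normT n) v)) ∧
    ZS.IsBasis (Sum.elim (fun n : ℤ => gradient (ZS.rho n) v)
      (fun n : ℤ => gradient (ZS.normU n) v)) := by
  have gnu : ∀ n, HasGradientAt (ZS.nu n) (ZS.evGrad (ZS.node 0 n) v) v := fun n => by
    rw [ZS.nu_eq]; exact ZS.hasGradientAt_ev _ v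
  have gs : ∀ n, HasGradientAt (ZS.normS n) (ZS.kapGrad (ZS.node 0 n) v) v := fun n => by
    rw [ZS.normS_eq]; exact ZS.hasGradientAt_kap _ v
  have grho : ∀ n w, HasGradientAt (ZS.rho n) (ZS.evGrad (ZS.node (Real.pi / 2) n) w) w :=
    fun n w => by rw [ZS.rho_eq]; exact ZS.hasGradientAt_ev _ w
  have gu : ∀ n w, HasGradientAt (ZS.normU n) (ZS.kapGrad (ZS.node (Real.pi / 2) n) w) w :=
    fun n w => by rw [ZS.normU_eq]; exact ZS.hasGradientAt_kap _ w
  -- Both families of the `τ` problem are those of the `ϱ` problem composed with `v ↦ -v`. Their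
  -- gradients thus acquire a common sign, which affects neither the wedge nor the basis property.
  have gtau : ∀ n, HasGradientAt (ZS.tau n) (-ZS.evGrad (ZS.node (Real.pi / 2) n) (-v)) v :=
    fun n => by rw [ZS.tau_eq]; exact ZS.hasGradientAt_comp_neg (grho n (-v))
  have gt : ∀ n, HasGradientAt (ZS.normT n) (-ZS.kapGrad (ZS.node (Real.pi / 2) n) (-v)) v :=
    fun n => by rw [ZS.normT_eq]; exact ZS.hasGradientAt_comp_neg (gu n (-v))
  refine ⟨⟨?_, ?_, ?_⟩, fun n => ⟨(gnu n).differentiableAt, (gs n).differentiableAt,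
    (gtau n).differentiableAt, (gt n).differentiableAt, (grho n v).differentiableAt,
    (gu n v).differentiableAt⟩, fun n j => ?_, ?_, ?_, ?_⟩
  · rw [ZS.node_zero_eq]; exact ZS.isLabelling_nu v
  · rw [ZS.node_half_eq]; exact ZS.isLabelling_tau v
  · rw [ZS.node_half_eq]; exact ZS.isLabelling_rho v
  · simp only [(gnu _).gradient, (gs _).gradient, (gtau _).gradient, (gt _).gradient,
      (grho _ v).gradient, (gu _ v).gradient, ZS.wedge_neg_neg]
    exact ⟨ZS.wedge_relations 0 v n j, ZS.wedge_relations _ (-v) n j, ZS.wedge_relations _ v n j⟩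
  · simp only [(gnu _).gradient, (gs _).gradient]
    exact ZS.isBasis_grad 0 v
  · simp only [(gtau _).gradient, (gt _).gradient]
    convert (ZS.isBasis_grad (Real.pi / 2) (-v)).neg using 1
    ext i
    cases i <;> rfl
  · simp only [(grho _ v).gradient, (gu _ v).gradient]
    exact ZS.isBasis_grad _ v
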